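/- **Theorem 5.3.** Let $(R,\mathfrak m)$ be a Noetherian commutative local ring of Krull dimension $0$ with residue field $k=R/\mathfrak m$, and let $E=E_R(k)$ be the injective hull of $k$ over $R$. The following are equivalent. 1. $R$ is injective as an $R$-module. 2. $R\cong E$ as $R$-modules. 3. $(0)$ is an irreducible ideal of $R$, i.e. whenever $(0)=J\cap K$ for ideals $J,K$ of $R$, one has $J=(0)$ or $K=(0)$. 4. The socle $\operatorname{soc}(R)=\{y\in R\mid \mathfrak m y=0\}$ is a $1$-dimensional $k$-vector space. 5. $R$ is Gorenstein in the sense of Grothendieck/Serre, i.e. there is a regular local ring $S$ and a surjective ring homomorphism $S\to R$ for which the following condition holds: $R$ is Cohen–Macaulay (its depth equals its dimension) and, with $n=\dim S$ and $d=\dim R$, the dualizing module $\operatorname{Ext}_S^{\,n-d}(R,S)$ is a free $R$-module of rank $1$. Moreover, the condition in (5) does not depend on the presentation: $R$ is Gorenstein in this sense if and only if the condition holds for any given surjection from a regular local ring $S$ onto $R$. -/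

import Mathlib

open CategoryTheory IsLocalRing

universe u

/-- An injective `R`-linear map `i : M → E` exhibits `E` as an injective hull of `M` when `E` is an
injective module and `E` is an essential extension of the image of `M`: every submodule of `E` that
meets the image trivially is zero. -/
structure IsInjectiveHull {R : Type u} [CommRing R] {M E : Type u} [AddCommGroup M] [Module R M]
    [AddCommGroup E] [Module R E] (i : M →ₗ[R] E) : Prop where
  injective_map : Function.Injective i
  essential : ∀ K : Submodule R E, K ⊓ LinearMap.range i = ⊥ → K = ⊥
  injective_module : Module.Injective R E

/-- Every module that embeds into an injective module `J` has an injective hull inside `J`. -/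
theorem exists_isInjectiveHull_submodule {R : Type u} [CommRing R] {M J : Type u} [AddCommGroup M]
    [Module R M] [AddCommGroup J] [Module R J] (hJ : Module.Injective R J) (i : M →ₗ[R] J)
    (hi : Function.Injective i) :
    ∃ (N : Submodule R J) (j : M →ₗ[R] N), IsInjectiveHull j := by
  -- a maximal essential extension of the image inside `J`
  obtain ⟨N, -, hN⟩ := zorn_le_nonempty₀
    {N : Submodule R J | LinearMap.range i ≤ N ∧ ∀ K ≤ N, K ⊓ LinearMap.range i = ⊥ → K = ⊥}
    (by
      intro c hc hch N₀ hN₀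
      refine ⟨sSup c, ⟨(hc hN₀).1.trans (le_sSup hN₀), ?_⟩, fun z hz => le_sSup hz⟩
      intro K hK hKi
      rw [Submodule.eq_bot_iff]
      intro x hx
      obtain ⟨N₁, hN₁, hx₁⟩ :=
        (Submodule.mem_sSup_of_directed ⟨N₀, hN₀⟩ hch.directedOn).1 (hK hx)
      have h1 : Submodule.span R {x} ≤ K := by simpa using hx
      have h2 : Submodule.span R {x} ≤ N₁ := by simpa using hx₁
      have h3 := (hc hN₁).2 _ h2 (eq_bot_iff.2 ((inf_le_inf_right _ h1).trans hKi.le))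
      simpa using h3)
    (LinearMap.range i) ⟨le_rfl, fun K hK h => by rwa [inf_eq_left.2 hK] at h⟩
  obtain ⟨⟨hiN, hNe⟩, hNmax⟩ := hN
  -- a maximal submodule that meets `N` trivially
  obtain ⟨C, -, hC⟩ := zorn_le_nonempty₀ {C : Submodule R J | C ⊓ N = ⊥}
    (by
      intro c hc hch C₀ hC₀
      refine ⟨sSup c, ?_, fun z hz => le_sSup hz⟩
      rw [Set.mem_ofPred_eq, Submodule.eq_bot_iff]
      rintro x ⟨hx, hxN⟩
      obtain ⟨C₁, hC₁, hx₁⟩ :=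
        (Submodule.mem_sSup_of_directed ⟨C₀, hC₀⟩ hch.directedOn).1 hx
      exact (Submodule.eq_bot_iff _).1 (hc hC₁) x ⟨hx₁, hxN⟩)
    ⊥ (by simp)
  obtain ⟨hCN, hCmax⟩ := hC
  have hCN' : ∀ x ∈ C, x ∈ N → x = 0 := fun x h1 h2 => (Submodule.eq_bot_iff _).1 hCN x ⟨h1, h2⟩
  set p : N →ₗ[R] J ⧸ C := C.mkQ ∘ₗ N.subtype with hp
  have hpinj : Function.Injective p := by
    rw [injective_iff_map_eq_zero]
    intro x hx
    have : (x : J) ∈ C := by simpa [hp] using hx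
    exact Subtype.ext (hCN' _ this x.2)
  have hpess : ∀ K : Submodule R (J ⧸ C), (∀ x, p x ∈ K → x = 0) → K = ⊥ := by
    intro K hK
    have hle : C ≤ K.comap C.mkQ := by
      intro x hx
      have : C.mkQ x = 0 := by simpa using hx
      simp [Submodule.mem_comap, this]
    have hmem : K.comap C.mkQ ⊓ N = ⊥ := by
      rw [Submodule.eq_bot_iff]
      rintro x ⟨hx, hxN⟩
      exact congrArg Subtype.val (hK ⟨x, hxN⟩ hx)
    have hle2 := hCmax hmem hle
    rw [Submodule.eq_bot_iff]
    intro y hy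
    obtain ⟨x, rfl⟩ := C.mkQ_surjective y
    simpa using hle2 hy
  obtain ⟨g, hg⟩ := hJ.out p hpinj N.subtype
  have hginj : LinearMap.ker g = ⊥ := hpess _ fun x hx => by
    have h1 : g (p x) = 0 := hx
    rw [hg] at h1
    exact Subtype.ext h1
  have hNg : N ≤ LinearMap.range g := fun x hx => ⟨p ⟨x, hx⟩, hg ⟨x, hx⟩⟩
  have hgN : LinearMap.range g ≤ N := by
    refine hNmax ⟨hiN.trans hNg, ?_⟩ hNg
    intro K hK hKi
    have hKN : K ⊓ N = ⊥ := hNe _ inf_le_right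
      (eq_bot_iff.2 ((inf_le_inf_right _ inf_le_left).trans hKi.le))
    have hcomap : K.comap g = ⊥ := hpess _ fun x hx => by
      have h1 : g (p x) ∈ K := hx
      rw [hg] at h1
      exact Subtype.ext ((Submodule.eq_bot_iff _).1 hKN _ ⟨h1, x.2⟩)
    rw [Submodule.eq_bot_iff]
    intro y hy
    obtain ⟨x, rfl⟩ := hK hy
    have : x ∈ K.comap g := hy
    rw [hcomap, Submodule.mem_bot] at this
    simp [this]
  let r : J →ₗ[R] N := (g ∘ₗ C.mkQ).codRestrict N fun x => hgN ⟨_, rfl⟩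
  have hr : ∀ x : N, r x = x := fun x => Subtype.ext (hg x)
  refine ⟨N, i.codRestrict N fun x => hiN ⟨x, rfl⟩, ?_, ?_, ⟨?_⟩⟩
  · intro a b hab
    exact hi (congrArg Subtype.val hab)
  · intro K hK
    have h1 : K.map N.subtype = ⊥ := by
      refine hNe _ (Submodule.map_subtype_le N K) ?_
      rw [Submodule.eq_bot_iff]
      rintro _ ⟨⟨x, hx, rfl⟩, m, hm⟩
      have : x = 0 := (Submodule.eq_bot_iff _).1 hK x ⟨hx, m, Subtype.ext hm⟩
      simp [this]
    rw [Submodule.eq_bot_iff] at h1 ⊢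
    exact fun x hx => Subtype.ext (h1 x ⟨x, hx, rfl⟩)
  · intro X Y _ _ _ _ f hf q
    obtain ⟨h, hh⟩ := hJ.out f hf (N.subtype ∘ₗ q)
    refine ⟨r ∘ₗ h, fun x => ?_⟩
    have : h (f x) = (q x : J) := hh x
    simp [this, hr]

section

variable (R : Type u) [CommRing R] (M : Type u) [AddCommGroup M] [Module R M]

/-- An injective module that contains `M`. -/
noncomputable abbrev ambientInjectiveModule : ModuleCat.{u} R :=
  Injective.under (ModuleCat.of R M)

theorem exists_isInjectiveHull_under :
    ∃ (N : Submodule R (ambientInjectiveModule R M)) (j : M →ₗ[R] N), IsInjectiveHull j := by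
  have h : Injective (ambientInjectiveModule R M) := inferInstance
  exact exists_isInjectiveHull_submodule ((Module.injective_iff_injective_object R _).2 h)
    (Injective.ι (ModuleCat.of R M)).hom ((ModuleCat.mono_iff_injective _).1 inferInstance)

/-- The injective hull `E_R(M)`, realized inside an injective module that contains `M`. -/
noncomputable def injectiveHull : Submodule R (ambientInjectiveModule R M) :=
  (exists_isInjectiveHull_under R M).choose

/-- The embedding of `M` in its injective hull. -/
noncomputable def injectiveHullMap : M →ₗ[R] injectiveHull R M :=
  (exists_isInjectiveHull_under R M).choose_spec.choose

theorem isInjectiveHull_injectiveHullMap : IsInjectiveHull (injectiveHullMap R M) :=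
  (exists_isInjectiveHull_under R M).choose_spec.choose_spec

end

/-- The socle `{y ∈ M | m y = 0}` of a module over a local ring `(R, m)`. -/
abbrev socle (R : Type u) [CommRing R] [IsLocalRing R] (M : Type u) [AddCommGroup M]
    [Module R M] : Submodule R M :=
  Submodule.torsionBySet R M (maximalIdeal R : Set R)

/-- The socle as a vector space over the residue field `R / m`; a residue class acts through any
representative. -/
noncomputable instance socle.moduleResidueField (R : Type u) [CommRing R] [IsLocalRing R]
    (M : Type u) [AddCommGroup M] [Module R M] : Module (ResidueField R) (socle R M) :=
  inferInstanceAs (Module (R ⧸ maximalIdeal R) (Submodule.torsionBySet R M (maximalIdeal R)))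

/-- The depth of a module over a (local) ring: the supremum of the lengths of the regular
sequences on it. -/
noncomputable def moduleDepth (R : Type u) [CommRing R] (M : Type u) [AddCommGroup M]
    [Module R M] : ℕ∞ :=
  ⨆ (rs : List R) (_ : RingTheory.Sequence.IsRegular M rs), (rs.length : ℕ∞)

/-- A Noetherian local ring is Cohen-Macaulay if its depth equals its dimension. -/
def IsCohenMacaulayLocal (R : Type u) [CommRing R] : Prop :=
  IsLocalRing R ∧ IsNoetherianRing R ∧ (moduleDepth R R : WithBot ℕ∞) = ringKrullDim R

/-- Let `R` be a quotient ring of a regular local ring `S` with `dim S = n` and `dim R = d`. Then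
`R` is Gorenstein in the sense of Grothendieck and Serre, as a quotient of `S`, if `R` is
Cohen-Macaulay and its dualizing module `Ext_S^{n-d}(R, S)` is free of rank one over `R`.
As `S → R` is surjective, a linear map between `R`-modules over `S` is the same as one over `R`,
and so the last condition says that the `S`-module `Ext_S^{n-d}(R, S)` is isomorphic to `R`. -/
structure IsGorensteinAsQuotient (S : Type u) [CommRing S] (R : Type u) [CommRing R]
    [Algebra S R] : Prop where
  regular : IsRegularLocalRing S
  surjective : Function.Surjective (algebraMap S R)
  cohenMacaulay : IsCohenMacaulayLocal R
  dualizing : ∃ n d : ℕ, ringKrullDim S = n ∧ ringKrullDim R = d ∧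
    Nonempty (Abelian.Ext (ModuleCat.of S R) (ModuleCat.of S S) (n - d) ≃ₗ[S] R)

/-- A local ring `R` is Gorenstein in the sense of Grothendieck and Serre if it is a quotient of
some regular local ring `S` and satisfies the above condition for `S`. -/
def IsGrothendieckSerreGorenstein (R : Type u) [CommRing R] : Prop :=
  ∃ (S : Type u) (_ : CommRing S) (_ : Algebra S R), IsGorensteinAsQuotient S R

/-! A Noetherian local ring of dimension zero is Artinian with nilpotent maximal ideal, so every
nonzero submodule meets the socle, and the five conditions all come down to `HasSimpleSocle R R`. If
R is injective and J ∩ K = 0, the projection J × K → J extends to multiplication by some e in R; as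
e or 1 - e is a unit, K or J vanishes. If (0) is irreducible, nonzero socle elements y, z generate
ideals that meet, so y is a multiple of z. If the socle is simple, Hom(-, R) does not increase
length (`length_linearMap_le`), and a length count yields Baer's criterion. A self-injective R is an
essential extension of its socle, a copy of k, and hence is E.

For (5), let S be regular local of dimension n with a surjection onto R. The maximal ideal of S is
generated by a regular sequence of length n, and high powers of its members form a regular sequence
that vanishes in R. Let J be the ideal of these powers. Rees's lemma (`ext_of_isWeaklyRegular`)
gives Ext^n(X, S) ≅ Hom(X, S/J) whenever the powers kill X. For X = k, comparison with the original
sequence shows that S/J has simple socle, so S/J is self-injective. For X = R, the dualizing module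
is Hom(R, S/J), whose socle is simple too; if it is isomorphic to R, then R has simple socle.
Conversely, an R with simple socle embeds in S/J onto the annihilator of ker(S/J → R), which is
Hom(R, S/J). The resulting criterion does not mention S, whence the independence of the
presentation.

That a suitable S exists is Cohen's structure theorem for Artinian rings: R receives a map from a
principal ideal domain V that is onto the residue field (V = k in characteristic zero, a discrete
valuation ring with uniformizer p in characteristic p). Then R is a quotient of a localization of a
polynomial ring over V. -/

/-- The socle of `M` is a cyclic nonzero submodule: it is generated by one nonzero element. -/
def HasSimpleSocle (R : Type*) [CommRing R] [IsLocalRing R] (M : Type*) [AddCommGroup M]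
    [Module R M] : Prop :=
  ∃ z : M, z ≠ 0 ∧ (∀ a ∈ maximalIdeal R, a • z = 0) ∧
    ∀ y : M, (∀ a ∈ maximalIdeal R, a • y = 0) → ∃ s : R, y = s • z

/-! ### Socles over a local ring -/

section Socle

variable {R : Type*} [CommRing R] [IsLocalRing R] {M N : Type*} [AddCommGroup M] [Module R M]
  [AddCommGroup N] [Module R N]

theorem HasSimpleSocle.of_linearEquiv (h : HasSimpleSocle R M) (e : M ≃ₗ[R] N) :
    HasSimpleSocle R N := by
  obtain ⟨z, hz, hmz, hy⟩ := h
  refine ⟨e z, by simpa using hz, fun a ha => by rw [← map_smul, hmz a ha, map_zero], ?_⟩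
  intro y h
  obtain ⟨s, hs⟩ := hy (e.symm y) fun a ha => by rw [← map_smul, h a ha, map_zero]
  exact ⟨s, by rw [← map_smul, ← hs, e.apply_symm_apply]⟩

theorem hasSimpleSocle_iff_finrank (R : Type u) [CommRing R] [IsLocalRing R] (M : Type u)
    [AddCommGroup M] [Module R M] :
    HasSimpleSocle R M ↔ Module.finrank (ResidueField R) (socle R M) = 1 := by
  have hmem : ∀ y : M, y ∈ socle R M ↔ ∀ a ∈ maximalIdeal R, a • y = 0 := fun y => by
    simp [socle, Submodule.mem_torsionBySet_iff]
  have hsmul : ∀ (s : R) (y : socle R M), (((residue R s) • y : socle R M) : M) = s • (y : M) :=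
    fun s y => rfl
  rw [finrank_eq_one_iff']
  constructor
  · rintro ⟨z, hz, hmz, hy⟩
    refine ⟨⟨z, (hmem z).2 hmz⟩, fun h => hz (congrArg Subtype.val h), ?_⟩
    rintro ⟨y, hy'⟩
    obtain ⟨s, hs⟩ := hy y ((hmem y).1 hy')
    exact ⟨residue R s, Subtype.ext (by rw [hsmul]; exact hs.symm)⟩
  · rintro ⟨⟨z, hz'⟩, hz, hy⟩
    refine ⟨z, fun h => hz (Subtype.ext h), (hmem z).1 hz', fun y h => ?_⟩
    obtain ⟨c, hc⟩ := hy ⟨y, (hmem y).2 h⟩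
    obtain ⟨s, rfl⟩ := residue_surjective c
    exact ⟨s, by rw [← hsmul s ⟨z, hz'⟩, hc]⟩

/-- Over a local ring with nilpotent maximal ideal every nonzero submodule meets the socle. -/
theorem exists_ne_zero_mem_socle (hnil : IsNilpotent (maximalIdeal R)) {K : Submodule R M}
    (hK : K ≠ ⊥) : ∃ y ∈ K, y ≠ 0 ∧ ∀ a ∈ maximalIdeal R, a • y = 0 := by
  obtain ⟨x, hxK, hx⟩ := Submodule.exists_mem_ne_zero_of_ne_bot hK
  -- For the least n with m^n x = 0, a nonzero multiple of x by an element of m^(n-1) lies in the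
  -- socle.
  have hex : ∃ n, ∀ a ∈ maximalIdeal R ^ n, a • x = 0 := by
    obtain ⟨n, hn⟩ := hnil
    refine ⟨n, fun a ha => ?_⟩
    rw [hn] at ha
    rw [show a = 0 from ha, zero_smul]
  classical
  obtain ⟨n, hn⟩ : ∃ n, Nat.find hex = n := ⟨_, rfl⟩
  have hspec := Nat.find_spec hex
  rw [hn] at hspec
  cases n with
  | zero => exact absurd (by simpa using hspec 1 (by simp)) hx
  | succ n =>
    have := Nat.find_min hex (m := n) (by omega)
    push Not at this
    obtain ⟨a, ha, hax⟩ := this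
    refine ⟨a • x, K.smul_mem _ hxK, hax, fun b hb => ?_⟩
    rw [smul_smul]
    exact hspec _ (by rw [pow_succ']; exact Ideal.mul_mem_mul hb ha)

/-- A generator of a simple socle lies in every nonzero submodule. -/
theorem socle_generator_mem (hnil : IsNilpotent (maximalIdeal R)) {z : M}
    (hmz : ∀ a ∈ maximalIdeal R, a • z = 0)
    (hz : ∀ y : M, (∀ a ∈ maximalIdeal R, a • y = 0) → ∃ s : R, y = s • z) {K : Submodule R M}
    (hK : K ≠ ⊥) : z ∈ K := by
  obtain ⟨y, hyK, hy0, hy⟩ := exists_ne_zero_mem_socle hnil hK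
  obtain ⟨s, rfl⟩ := hz y hy
  by_cases hs : IsUnit s
  · exact (K.smul_mem_iff_of_isUnit hs).1 hyK
  · exact absurd (hmz s ((mem_maximalIdeal s).2 hs)) hy0

end Socle

/-! ### Self-injectivity, irreducibility of zero and simple socle -/

section Injective

variable {R : Type u} [CommRing R] [IsLocalRing R]

/-- The projection J × K → J extends to R as multiplication by an element that acts as 1 on J and as
0 on K. In a local ring this element or its complement to 1 is a unit. -/
theorem infIrred_bot_of_injective (h : Module.Injective R R) : InfIrred (⊥ : Ideal R) := by
  refine ⟨fun hmax => ?_, fun {J K} hJK => ?_⟩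
  · exact bot_ne_top (isMax_iff_eq_top.1 hmax)
  · have hdisj : ∀ x ∈ J, ∀ y ∈ K, x = y → x = 0 := fun x hx y hy hxy => by
      have : x ∈ J ⊓ K := ⟨hx, hxy ▸ hy⟩
      rwa [hJK, Ideal.mem_bot] at this
    let f : (J × K) →ₗ[R] R := J.subtype.coprod K.subtype
    have hf : Function.Injective f := by
      rw [injective_iff_map_eq_zero]
      rintro ⟨⟨x, hx⟩, ⟨y, hy⟩⟩ hxy
      have hxy : x + y = 0 := by simpa [f] using hxy
      have hx0 : x = 0 := hdisj x hx (-y) (K.neg_mem hy) (eq_neg_of_add_eq_zero_left hxy)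
      have hy0 : y = 0 := by simpa [hx0] using hxy
      simp [hx0, hy0]
    obtain ⟨g, hg⟩ := h.out f hf (J.subtype ∘ₗ LinearMap.fst R J K)
    have hg1 : ∀ x, g x = x * g 1 := fun x => by
      rw [← smul_eq_mul, ← map_smul, smul_eq_mul, mul_one]
    have hJ : ∀ x ∈ J, x * g 1 = x := fun x hx => by
      have := hg (⟨x, hx⟩, 0)
      simpa [f, hg1 x] using this
    have hK : ∀ y ∈ K, y * g 1 = 0 := fun y hy => by
      have := hg (0, ⟨y, hy⟩)
      simpa [f, hg1 y] using this
    rcases IsLocalRing.isUnit_or_isUnit_one_sub_self (g 1) with hu | hu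
    · right
      rw [eq_bot_iff]
      exact fun y hy => (hu.mul_left_eq_zero).1 (hK y hy)
    · left
      rw [eq_bot_iff]
      exact fun x hx => (hu.mul_left_eq_zero).1 (by rw [mul_sub, mul_one, hJ x hx, sub_self])

/-- If s y = t z is a nonzero common element of the ideals of two socle elements, then s is a unit,
since nonunits kill y. -/
theorem hasSimpleSocle_of_infIrred_bot (hnil : IsNilpotent (maximalIdeal R))
    (h : InfIrred (⊥ : Ideal R)) : HasSimpleSocle R R := by
  obtain ⟨z, -, hz0, hmz⟩ := exists_ne_zero_mem_socle (R := R) (M := R) hnil (K := ⊤) (by simp)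
  refine ⟨z, hz0, hmz, fun y hy => ?_⟩
  by_cases hy0 : y = 0
  · exact ⟨0, by simp [hy0]⟩
  have hne : Ideal.span {y} ⊓ Ideal.span {z} ≠ ⊥ := fun hbot => by
    rcases h.2 hbot with h1 | h1
    · exact hy0 (by simpa using h1)
    · exact hz0 (by simpa using h1)
  obtain ⟨w, ⟨hwy, hwz⟩, hw0⟩ := Submodule.exists_mem_ne_zero_of_ne_bot hne
  obtain ⟨s, rfl⟩ := Ideal.mem_span_singleton'.1 hwy
  obtain ⟨t, ht⟩ := Ideal.mem_span_singleton'.1 hwz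
  have hs : IsUnit s := by
    by_contra hs
    exact hw0 (hy s ((mem_maximalIdeal s).2 hs))
  obtain ⟨u, rfl⟩ := hs
  exact ⟨↑u⁻¹ * t, by rw [smul_eq_mul, mul_assoc, ht, Units.inv_mul_cancel_left]⟩

/-- Induction along a composition series: each simple factor k contributes at most Hom(k, Q), that
is, the socle of Q, which has length one. -/
theorem length_linearMap_le {M : Type*} [AddCommGroup M] [Module R M] (hM : IsFiniteLength R M)
    {Q : Type*} [AddCommGroup Q] [Module R Q] (hQ : HasSimpleSocle R Q) :
    Module.length R (M →ₗ[R] Q) ≤ Module.length R M := by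
  induction hM with
  | of_subsingleton => simp
  | @of_simple_quotient M _ _ N hsimple hN ih =>
    have hker : Module.length R (LinearMap.ker (LinearMap.lcomp R Q N.subtype)) ≤ 1 := by
      obtain ⟨z, hz0, hmz, hz⟩ := hQ
      have := IsSimpleModule.nontrivial R (M ⧸ N)
      obtain ⟨m, hm⟩ := exists_ne (0 : M ⧸ N)
      have hspan := IsSimpleModule.toSpanSingleton_surjective R hm
      obtain ⟨m, rfl⟩ := N.mkQ_surjective m
      have hann : Module.annihilator R (M ⧸ N) = maximalIdeal R :=
        eq_maximalIdeal (IsSimpleModule.annihilator_isMaximal)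
      have hmN : ∀ a ∈ maximalIdeal R, a • m ∈ N := fun a ha => by
        rw [← hann, Module.mem_annihilator] at ha
        simpa [← Submodule.Quotient.mk_smul] using ha (N.mkQ m)
      let g : (R ⧸ maximalIdeal R) →ₗ[R] Q :=
        Submodule.liftQ (maximalIdeal R) (LinearMap.toSpanSingleton R Q z) fun a ha => hmz a ha
      have hmem : ∀ φ : LinearMap.ker (LinearMap.lcomp R Q N.subtype), ∀ x ∈ N, φ.1 x = 0 :=
        fun φ x hx => LinearMap.congr_fun φ.2 (⟨x, hx⟩ : N)
      -- Evaluation at a lift m of a generator of M / N. A map that vanishes on N sends m into the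
      -- socle R z, the range of `g`.
      let e : LinearMap.ker (LinearMap.lcomp R Q N.subtype) →ₗ[R] LinearMap.range g :=
        (LinearMap.applyₗ m ∘ₗ Submodule.subtype _).codRestrict _ fun φ => by
          obtain ⟨s, hs⟩ := hz (φ.1 m) fun a ha => by
            rw [← map_smul, hmem φ _ (hmN a ha)]
          refine ⟨(maximalIdeal R).mkQ s, ?_⟩
          show LinearMap.toSpanSingleton R Q z s = φ.1 m
          rw [hs, LinearMap.toSpanSingleton_apply]
      have he : Function.Injective e := by
        rw [injective_iff_map_eq_zero]
        intro φ hφ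
        have hφm : φ.1 m = 0 := congrArg Subtype.val hφ
        refine Subtype.ext (LinearMap.ext fun x => ?_)
        obtain ⟨s, hs⟩ := hspan (N.mkQ x)
        have hxs : x - s • m ∈ N := by
          rw [← Submodule.Quotient.mk_eq_zero, Submodule.Quotient.mk_sub, sub_eq_zero]
          exact hs.symm
        have := hmem φ _ hxs
        rw [map_sub, map_smul, hφm, smul_zero, sub_zero] at this
        simpa using this
      have hsimp : IsSimpleModule R (R ⧸ maximalIdeal R) :=
        isSimpleModule_iff_isCoatom.2 (maximalIdeal.isMaximal R).out
      calc _ ≤ Module.length R (LinearMap.range g) := Module.length_le_of_injective e he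
        _ ≤ Module.length R (R ⧸ maximalIdeal R) :=
          Module.length_le_of_surjective _ g.surjective_rangeRestrict
        _ = 1 := Module.length_eq_one R _
    have h1 := Module.length_eq_add_of_exact (LinearMap.ker (LinearMap.lcomp R Q N.subtype)).subtype
      (LinearMap.lcomp R Q N.subtype).rangeRestrict (Submodule.subtype_injective _)
      (LinearMap.surjective_rangeRestrict _) (by
        rw [LinearMap.exact_iff, LinearMap.ker_rangeRestrict, Submodule.range_subtype])
    have h2 : Module.length R M = Module.length R N + Module.length R (M ⧸ N) :=
      Module.length_eq_add_of_exact N.subtype N.mkQ (Submodule.subtype_injective _)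
        N.mkQ_surjective (LinearMap.exact_subtype_mkQ N)
    rw [h1, h2, Module.length_eq_one R (M ⧸ N), add_comm]
    gcongr
    exact (Module.length_le_of_injective _ (Submodule.subtype_injective _)).trans ih

/-- The kernel of restriction Hom(R, R) → Hom(J, R) is a quotient of Hom(R/J, R), so has length at
most that of R/J. The image then has length at least that of J, which bounds the length of Hom(J,
R); so restriction is onto. -/
theorem injective_of_hasSimpleSocle [IsArtinianRing R] (h : HasSimpleSocle R R) :
    Module.Injective R R := by
  apply Module.Baer.injective
  rw [Module.Baer.iff_surjective]
  intro J
  have hfin : ∀ (X : Type u) [AddCommGroup X] [Module R X] [Module.Finite R X],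
      IsFiniteLength R X := fun X _ _ _ =>
    isFiniteLength_iff_isNoetherian_isArtinian.2 ⟨inferInstance, inferInstance⟩
  set ρ := LinearMap.lcomp R R J.subtype with hρ
  have hker : Module.length R (LinearMap.ker ρ) ≤ Module.length R (R ⧸ J) := by
    let e : (R ⧸ J →ₗ[R] R) →ₗ[R] LinearMap.ker ρ :=
      (LinearMap.lcomp R R J.mkQ).codRestrict _ fun φ => by
        ext x
        show φ (Submodule.Quotient.mk x) = 0
        rw [(Submodule.Quotient.mk_eq_zero J).2 x.2, map_zero]
    have he : Function.Surjective e := fun φ =>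
      ⟨Submodule.liftQ J φ.1 fun x hx => LinearMap.congr_fun φ.2 (⟨x, hx⟩ : J),
        Subtype.ext (LinearMap.ext fun x => rfl)⟩
    exact (Module.length_le_of_surjective e he).trans (length_linearMap_le (hfin _) h)
  have hex : Function.Exact (LinearMap.ker ρ).subtype ρ.rangeRestrict := by
    rw [LinearMap.exact_iff, LinearMap.ker_rangeRestrict, Submodule.range_subtype]
  have h1 : Module.length R (R →ₗ[R] R) =
      Module.length R (LinearMap.ker ρ) + Module.length R (LinearMap.range ρ) :=
    Module.length_eq_add_of_exact (LinearMap.ker ρ).subtype ρ.rangeRestrict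
      (Submodule.subtype_injective _) (LinearMap.surjective_rangeRestrict _) hex
  have h2 : Module.length R R = Module.length R J + Module.length R (R ⧸ J) :=
    Module.length_eq_add_of_exact J.subtype J.mkQ (Submodule.subtype_injective _)
      J.mkQ_surjective (LinearMap.exact_subtype_mkQ J)
  rw [(LinearMap.ringLmapEquivSelf R R R).length_eq, h2, add_comm] at h1
  have hJ : Module.length R J ≤ Module.length R (LinearMap.range ρ) := by
    refine (ENat.add_le_add_iff_left (Module.length_ne_top (R := R) (M := R ⧸ J))).1 ?_
    rw [h1]
    gcongr
  rw [← LinearMap.range_eq_top]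
  by_contra hne
  have hlen := length_linearMap_le (hfin J) h
  have hfl : IsFiniteLength R (J →ₗ[R] R) := by
    rw [← Module.length_ne_top_iff]
    exact ne_top_of_le_ne_top (Module.length_ne_top_iff.2 (hfin J)) hlen
  obtain ⟨_, _⟩ := isFiniteLength_iff_isNoetherian_isArtinian.1 hfl
  exact absurd (hJ.trans_lt (Submodule.length_lt hne)) (not_lt.2 hlen)

end Injective

/-! ### Uniqueness of injective hulls and the hull of the residue field -/

section InjectiveHull

variable {R : Type u} [CommRing R] {M E E' : Type u} [AddCommGroup M] [Module R M]
  [AddCommGroup E] [Module R E] [AddCommGroup E'] [Module R E']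

/-- An extension g : E → E' of `i'` is injective because its kernel misses the image of `i`. It
splits, and its retraction is injective by the essentiality of E'. -/
theorem IsInjectiveHull.nonempty_linearEquiv {i : M →ₗ[R] E} {i' : M →ₗ[R] E'}
    (h : IsInjectiveHull i) (h' : IsInjectiveHull i') : Nonempty (E ≃ₗ[R] E') := by
  obtain ⟨g, hg⟩ := h'.injective_module.out i h.injective_map i'
  have hgi : Function.Injective g := by
    rw [← LinearMap.ker_eq_bot]
    apply h.essential
    rw [Submodule.eq_bot_iff]
    rintro _ ⟨hx, m, rfl⟩
    have : i' m = 0 := by rw [← hg]; exact hx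
    rw [(map_eq_zero_iff i' h'.injective_map).1 this, map_zero]
  obtain ⟨r, hr⟩ := h.injective_module.out g hgi LinearMap.id
  have hri : Function.Injective r := by
    rw [← LinearMap.ker_eq_bot]
    apply h'.essential
    rw [Submodule.eq_bot_iff]
    rintro _ ⟨hx, m, rfl⟩
    have : i m = 0 := by rw [← LinearMap.id_apply (R := R) (i m), ← hr, hg]; exact hx
    rw [(map_eq_zero_iff i h.injective_map).1 this, map_zero]
  exact ⟨LinearEquiv.symm (LinearEquiv.ofBijective r ⟨hri, fun x => ⟨g x, hr x⟩⟩)⟩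

/-- A self-injective R is itself a hull of k through 1 ↦ z, with z a socle generator: z lies in
every nonzero ideal, so the extension is essential. -/
theorem nonempty_linearEquiv_injectiveHull_iff [IsLocalRing R]
    (hnil : IsNilpotent (maximalIdeal R)) :
    Nonempty (R ≃ₗ[R] injectiveHull R (ResidueField R)) ↔ Module.Injective R R := by
  have hhull := isInjectiveHull_injectiveHullMap R (ResidueField R)
  constructor
  · rintro ⟨e⟩
    have := hhull.injective_module
    exact ((Module.Baer.iff_injective.2 this).of_equiv e.symm).injective
  · intro hinj
    obtain ⟨z, hz0, hmz, hz⟩ := hasSimpleSocle_of_infIrred_bot hnil (infIrred_bot_of_injective hinj)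
    let i : ResidueField R →ₗ[R] R :=
      Submodule.liftQ (maximalIdeal R) (LinearMap.toSpanSingleton R R z) fun a ha => hmz a ha
    have hi1 : i 1 = z := by
      show LinearMap.toSpanSingleton R R z 1 = z
      simp
    refine IsInjectiveHull.nonempty_linearEquiv (i := i) ⟨?_, fun K hK => ?_, hinj⟩ hhull
    · rw [← LinearMap.ker_eq_bot]
      refine Submodule.ker_liftQ_eq_bot _ _ _ fun a ha => ?_
      rw [mem_maximalIdeal]
      intro hu
      exact hz0 ((hu.smul_eq_zero).1 ha)
    · by_contra hne
      have : z ∈ K ⊓ LinearMap.range i := ⟨socle_generator_mem hnil hmz hz hne, 1, hi1⟩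
      rw [hK] at this
      exact hz0 this

end InjectiveHull

/-! ### Powers of regular sequences -/

section RegularSequences

open RingTheory.Sequence Pointwise

variable {R : Type*} [CommRing R]

theorem QuotSMulTop.map_injective_of_isSMulRegular {M₁ M₂ M₃ : Type*} [AddCommGroup M₁]
    [Module R M₁] [AddCommGroup M₂] [Module R M₂] [AddCommGroup M₃] [Module R M₃]
    {f : M₁ →ₗ[R] M₂} {g : M₂ →ₗ[R] M₃} (hf : Function.Injective f) (hfg : Function.Exact f g)
    {r : R} (hr : IsSMulRegular M₃ r) : Function.Injective (QuotSMulTop.map r f) := by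
  rw [injective_iff_map_eq_zero]
  intro x hx
  obtain ⟨x, rfl⟩ := Submodule.mkQ_surjective _ x
  have hx : Submodule.Quotient.mk (p := r • (⊤ : Submodule R M₂)) (f x) = 0 := hx
  rw [Submodule.Quotient.mk_eq_zero, Submodule.mem_smul_pointwise_iff_exists] at hx
  obtain ⟨y, -, hy⟩ := hx
  have hgy : g y = 0 := by
    refine hr ?_
    show r • g y = r • (0 : M₃)
    rw [← map_smul, hy, hfg.apply_apply_eq_zero, smul_zero]
  obtain ⟨w, rfl⟩ := (hfg y).1 hgy
  rw [← map_smul] at hy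
  rw [Submodule.mkQ_apply, Submodule.Quotient.mk_eq_zero, Submodule.mem_smul_pointwise_iff_exists]
  exact ⟨w, trivial, hf hy⟩

/-- Weak regularity of a sequence passes to the middle of a short exact sequence. -/
theorem isWeaklyRegular_of_exact (rs : List R) {M₁ M₂ M₃ : Type*} [AddCommGroup M₁] [Module R M₁]
    [AddCommGroup M₂] [Module R M₂] [AddCommGroup M₃] [Module R M₃]
    {f : M₁ →ₗ[R] M₂} {g : M₂ →ₗ[R] M₃} (hf : Function.Injective f) (hg : Function.Surjective g)
    (hfg : Function.Exact f g) (h₁ : IsWeaklyRegular M₁ rs) (h₃ : IsWeaklyRegular M₃ rs) :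
    IsWeaklyRegular M₂ rs := by
  induction rs generalizing M₁ M₂ M₃ with
  | nil => exact IsWeaklyRegular.nil R M₂
  | cons r rs ih =>
    rw [isWeaklyRegular_cons_iff] at h₁ h₃ ⊢
    exact ⟨isSMulRegular_of_range_eq_ker hf (LinearMap.exact_iff.1 hfg).symm h₁.1 h₃.1,
      ih (QuotSMulTop.map_injective_of_isSMulRegular hf hfg h₃.1)
        (QuotSMulTop.map_surjective r hg) (QuotSMulTop.map_exact r hfg hg) h₁.2 h₃.2⟩

theorem isWeaklyRegular_of_subsingleton (rs : List R) (M : Type*) [AddCommGroup M] [Module R M]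
    [Subsingleton M] : IsWeaklyRegular M rs := by
  induction rs generalizing M with
  | nil => exact IsWeaklyRegular.nil R M
  | cons r rs ih =>
    rw [isWeaklyRegular_cons_iff]
    exact ⟨Function.injective_of_subsingleton _, ih _⟩

/-- Multiplication by r^n gives an exact sequence 0 → M/rM → M/r^(n+1)M → M/r^nM → 0, so regularity
passes to the middle by induction. -/
theorem isWeaklyRegular_quotSMulTop_pow {M : Type*} [AddCommGroup M] [Module R M] {r : R}
    {rs : List R} (hr : IsSMulRegular M r) (h : IsWeaklyRegular (QuotSMulTop r M) rs) (n : ℕ) :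
    IsWeaklyRegular (QuotSMulTop (r ^ n) M) rs := by
  induction n with
  | zero =>
    have : Subsingleton (QuotSMulTop (r ^ 0) M) :=
      Submodule.Quotient.subsingleton_iff.2 (by simp)
    exact isWeaklyRegular_of_subsingleton _ _
  | succ n ih =>
    let f : QuotSMulTop r M →ₗ[R] QuotSMulTop (r ^ (n + 1)) M :=
      Submodule.mapQ _ _ (LinearMap.lsmul R M (r ^ n)) (by
        intro x hx
        obtain ⟨y, -, rfl⟩ := (Submodule.mem_smul_pointwise_iff_exists ..).1 hx
        refine (Submodule.mem_smul_pointwise_iff_exists ..).2 ⟨y, trivial, ?_⟩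
        rw [LinearMap.lsmul_apply, smul_smul, pow_succ])
    let g : QuotSMulTop (r ^ (n + 1)) M →ₗ[R] QuotSMulTop (r ^ n) M :=
      Submodule.factor (by
        intro x hx
        obtain ⟨y, -, rfl⟩ := (Submodule.mem_smul_pointwise_iff_exists ..).1 hx
        refine (Submodule.mem_smul_pointwise_iff_exists ..).2 ⟨r • y, trivial, ?_⟩
        simp [smul_smul, pow_succ])
    refine isWeaklyRegular_of_exact rs (f := f) (g := g) ?_ (Submodule.factor_surjective _) ?_ h ih
    · rw [injective_iff_map_eq_zero]
      intro x hx
      obtain ⟨x, rfl⟩ := Submodule.mkQ_surjective _ x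
      have hx : Submodule.Quotient.mk (p := r ^ (n + 1) • (⊤ : Submodule R M)) (r ^ n • x) = 0 := hx
      rw [Submodule.Quotient.mk_eq_zero, Submodule.mem_smul_pointwise_iff_exists] at hx
      obtain ⟨y, -, hy⟩ := hx
      rw [pow_succ, mul_smul] at hy
      rw [Submodule.mkQ_apply, Submodule.Quotient.mk_eq_zero,
        Submodule.mem_smul_pointwise_iff_exists]
      exact ⟨y, trivial, hr.pow n hy⟩
    · intro x
      obtain ⟨x, rfl⟩ := Submodule.mkQ_surjective _ x
      have h0 : g (Submodule.mkQ _ x) = 0 ↔ x ∈ r ^ n • (⊤ : Submodule R M) :=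
        Submodule.Quotient.mk_eq_zero _
      rw [h0, Submodule.mem_smul_pointwise_iff_exists]
      constructor
      · rintro ⟨y, -, rfl⟩
        exact ⟨Submodule.mkQ _ y, rfl⟩
      · rintro ⟨y, hy⟩
        obtain ⟨y, rfl⟩ := Submodule.mkQ_surjective _ y
        have hy : Submodule.Quotient.mk (p := r ^ (n + 1) • (⊤ : Submodule R M)) (r ^ n • y) =
          Submodule.Quotient.mk x := hy
        rw [Submodule.Quotient.eq, Submodule.mem_smul_pointwise_iff_exists] at hy
        obtain ⟨w, -, hw⟩ := hy
        refine ⟨y - r • w, trivial, ?_⟩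
        rw [smul_sub, smul_smul, ← pow_succ, hw, sub_sub_cancel]

theorem RingTheory.Sequence.IsWeaklyRegular.map_pow {M : Type*} [AddCommGroup M] [Module R M]
    {rs : List R} (h : IsWeaklyRegular M rs) (n : ℕ) :
    IsWeaklyRegular M (rs.map (· ^ n)) := by
  generalize hlen : rs.length = l
  induction l generalizing M rs with
  | zero =>
    rw [List.length_eq_zero_iff] at hlen
    subst hlen
    exact h
  | succ l ih =>
    cases rs with
    | nil => simp at hlen
    | cons r rs =>
      rw [isWeaklyRegular_cons_iff] at h
      rw [List.map_cons, isWeaklyRegular_cons_iff]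
      exact ⟨h.1.pow n, ih (isWeaklyRegular_quotSMulTop_pow h.1 h.2 n) (by simpa using hlen)⟩

end RegularSequences

/-! ### Rees's lemma on Ext and regular sequences -/

section Rees

open RingTheory.Sequence Pointwise Abelian

variable {S : Type u} [CommRing S]

/-- Multiplication by r on Ext can be computed on X, where it is zero. The long exact sequence of 0
→ M → M → M/rM → 0 therefore breaks into short pieces. -/
theorem ext_comp_mk₀_smul_eq_zero {X M : ModuleCat.{u} S} {r : S}
    (hr : r ∈ Module.annihilator S X) {n : ℕ} (x : Ext X M n) :
    x.comp (Ext.mk₀ (M.smulShortComplex r).f) (add_zero n) = 0 := by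
  have := Ext.postcomp_smul_id_eq_zero_of_mem_annihilator (M := M) hr n
  exact DFunLike.congr_fun (congrArg AddCommGrpCat.Hom.hom this) x

/-- Let `rs` be a weakly `M`-regular sequence of length `n` that annihilates `X`. Then
`Ext i X M = 0` for `i < n`, and `Ext n X M` is isomorphic to `Hom (X, M / rs M)`. -/
theorem ext_of_isWeaklyRegular (X M : ModuleCat.{u} S) (rs : List S)
    (hann : ∀ r ∈ rs, r ∈ Module.annihilator S X) (hreg : IsWeaklyRegular M rs) :
    (∀ i < rs.length, Subsingleton (Ext X M i)) ∧
      Nonempty (Ext X M rs.length ≃ₗ[S]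
        (X →ₗ[S] (M ⧸ (Ideal.ofList rs • ⊤ : Submodule S M)))) := by
  induction rs generalizing M with
  | nil =>
    refine ⟨by simp, ⟨Ext.linearEquiv₀ (R := S) ≪≫ₗ ModuleCat.homLinearEquiv (S := S) ≪≫ₗ
      LinearEquiv.congrRight (Submodule.quotEquivOfEqBot _ (by simp)).symm⟩⟩
  | cons r rs ih =>
    rw [isWeaklyRegular_cons_iff] at hreg
    have hr := hann r List.mem_cons_self
    have hse := hreg.1.smulShortComplex_shortExact
    obtain ⟨hvan, ⟨e⟩⟩ := ih (ModuleCat.of S (QuotSMulTop r M))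
      (fun s hs => hann s (List.mem_cons_of_mem _ hs)) hreg.2
    have hvan' : ∀ i < rs.length + 1, Subsingleton (Ext X M i) := by
      intro i hi
      refine subsingleton_of_forall_eq 0 fun x => ?_
      cases i with
      | zero =>
        have := hse.mono_f
        exact (map_eq_zero_iff _ (Ext.postcomp_mk₀_injective_of_mono X (M.smulShortComplex r).f)).1
          (ext_comp_mk₀_smul_eq_zero hr x)
      | succ i =>
        obtain ⟨y, rfl⟩ := Ext.covariant_sequence_exact₁ X hse x
          (ext_comp_mk₀_smul_eq_zero hr x) rfl
        have : Subsingleton (Ext X (M.smulShortComplex r).X₃ i) := hvan i (by omega)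
        rw [Subsingleton.elim y 0, Ext.zero_comp]
        rfl
    refine ⟨hvan', ⟨?_⟩⟩
    -- The connecting map is onto because r acts as zero on its target's successor term, and
    -- injective because Ext of X into M vanishes in degree `rs.length`.
    let δ : Ext X (M.smulShortComplex r).X₃ rs.length →ₗ[S] Ext X M (rs.length + 1) :=
      Ext.postcompOfLinear hse.extClass S X rfl
    have hδ : Function.Bijective δ := by
      constructor
      · rw [injective_iff_map_eq_zero]
        intro x hx
        obtain ⟨y, rfl⟩ := Ext.covariant_sequence_exact₃ X hse x rfl hx
        have : Subsingleton (Ext X (M.smulShortComplex r).X₂ rs.length) :=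
          hvan' rs.length (by omega)
        rw [Subsingleton.elim y 0, Ext.zero_comp]
      · intro x
        exact Ext.covariant_sequence_exact₁ X hse x (ext_comp_mk₀_smul_eq_zero hr x) rfl
    exact (LinearEquiv.ofBijective δ hδ).symm ≪≫ₗ e ≪≫ₗ
      LinearEquiv.congrRight (Submodule.quotOfListConsSMulTopEquivQuotSMulTopInner M r rs).symm

end Rees

/-! ### Regular local rings: generators of the maximal ideal -/

section RegularLocal

open RingTheory.Sequence Pointwise

theorem ringKrullDim_le_length {S : Type*} [CommRing S] [IsLocalRing S] [IsNoetherianRing S]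
    {rs : List S} (h : maximalIdeal S = Ideal.ofList rs) : ringKrullDim S ≤ rs.length := by
  refine (ringKrullDim_le_spanFinrank_maximalIdeal S).trans ?_
  rw [h]
  norm_cast
  classical
  have h1 : Ideal.ofList rs = Ideal.span (rs.toFinset : Set S) := by
    simp [Ideal.ofList]
  rw [h1]
  refine (Submodule.spanFinrank_span_le_ncard_of_finite (Finset.finite_toSet _)).trans ?_
  rw [Set.ncard_coe_finset]
  exact rs.toFinset_card_le

/-- P is the bottom of a chain of primes of length n. -/
theorem exists_isPrime_le_ringKrullDim_quotient {S : Type*} [CommRing S] {n : ℕ}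
    (h : (n : WithBot ℕ∞) ≤ ringKrullDim S) :
    ∃ P : Ideal S, P.IsPrime ∧ (n : WithBot ℕ∞) ≤ ringKrullDim (S ⧸ P) := by
  obtain ⟨p, hp⟩ := Order.le_krullDim_iff.1 h
  refine ⟨p.head.asIdeal, p.head.isPrime, ?_⟩
  rw [ringKrullDim_quotient]
  refine Order.le_krullDim_iff.2 ⟨⟨p.length, fun i => ⟨p i, p.monotone (Fin.zero_le i)⟩,
    fun i => p.step i⟩, hp⟩

/-- A Noetherian local ring whose maximal ideal is generated by `n ≤ dim S` elements is a domain
and these elements form a regular sequence. -/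
theorem isDomain_and_isWeaklyRegular_of_length_le {S : Type*} [CommRing S] [IsLocalRing S]
    [IsNoetherianRing S] {rs : List S} (h : maximalIdeal S = Ideal.ofList rs)
    (hd : (rs.length : WithBot ℕ∞) ≤ ringKrullDim S) :
    IsDomain S ∧ IsWeaklyRegular S rs := by
  generalize hn : rs.length = n
  induction n generalizing S with
  | zero =>
    rw [List.length_eq_zero_iff] at hn
    subst hn
    exact ⟨(isField_iff_maximalIdeal_eq.2 (by simpa using h)).isDomain, IsWeaklyRegular.nil S S⟩
  | succ n ih =>
    obtain _ | ⟨x, t⟩ := rs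
    · simp at hn
    have hnt : t.length = n := by simpa using hn
    have hx : x ∈ maximalIdeal S := by
      rw [h]
      exact Ideal.subset_span (by simp)
    have hnontriv : ∀ I : Ideal S, I ≤ maximalIdeal S → Nontrivial (S ⧸ I) := fun I hI =>
      Ideal.Quotient.nontrivial_iff.2 fun htop =>
        (maximalIdeal.isMaximal S).ne_top (top_le_iff.1 (htop ▸ hI))
    have hlocal : ∀ I : Ideal S, I ≤ maximalIdeal S → IsLocalRing (S ⧸ I) := fun I hI =>
      have := hnontriv I hI
      IsLocalRing.of_surjective' (Ideal.Quotient.mk I) Ideal.Quotient.mk_surjective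
    have hmap : ∀ (I : Ideal S) (hI : I ≤ maximalIdeal S),
        (maximalIdeal S).map (Ideal.Quotient.mk I) = @maximalIdeal (S ⧸ I) _ (hlocal I hI) :=
      fun I hI =>
        have := hlocal I hI
        map_maximalIdeal_of_surjective _ Ideal.Quotient.mk_surjective
    have hxle : Ideal.span {x} ≤ maximalIdeal S := (Ideal.span_singleton_le_iff_mem _).2 hx
    have := hlocal _ hxle
    have hmx : maximalIdeal (S ⧸ Ideal.span {x}) =
        Ideal.ofList (t.map (Ideal.Quotient.mk (Ideal.span {x}))) := by
      rw [← hmap _ hxle, h, Ideal.map_ofList, List.map_cons, Ideal.ofList_cons]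
      have : Ideal.Quotient.mk (Ideal.span {x}) x = 0 :=
        Ideal.Quotient.eq_zero_iff_mem.2 (Ideal.mem_span_singleton_self x)
      simp [this]
    have hxtop : x • (⊤ : Ideal S) = Ideal.span {x} := by
      simp [← Submodule.ideal_span_singleton_smul]
    rw [List.length_cons, hnt] at hd
    have hdx : (n : WithBot ℕ∞) ≤ ringKrullDim (S ⧸ Ideal.span {x}) := by
      have := ringKrullDim_le_ringKrullDim_quotSMulTop_succ hx
      rw [hxtop] at this
      have h1 := hd.trans this
      rw [Nat.cast_add, Nat.cast_one] at h1
      exact ENat.WithBot.add_le_add_one_right_iff.1 h1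
    obtain ⟨hdom, hreg⟩ := ih hmx (by simpa [hnt] using hdx) (by simpa using hnt)
    have hdimx : ringKrullDim (S ⧸ Ideal.span {x}) ≤ n := by
      simpa [hnt] using ringKrullDim_le_length hmx
    obtain ⟨P, hP, hdP⟩ := exists_isPrime_le_ringKrullDim_quotient hd
    have hPm : P ≤ maximalIdeal S := le_maximalIdeal hP.ne_top
    have hxP : x ∉ P := fun hxP => by
      have h1 := ringKrullDim_le_of_surjective
        (Ideal.Quotient.factor ((Ideal.span_singleton_le_iff_mem P).2 hxP))
        (Ideal.Quotient.factor_surjective _)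
      have h2 := (hdP.trans h1).trans hdimx
      norm_cast at h2
      omega
    -- If p ∈ P lies outside (x), its class in the domain S/(x) is nonzero, so dim S/(P, x) ≤ n - 1.
    -- But dim S/(P, x) ≥ dim S/P - 1 ≥ n.
    have hPx : P ≤ Ideal.span {x} := by
      intro p hp
      by_contra hpx
      have := hlocal P hPm
      have hxm : Ideal.Quotient.mk P x ∈ maximalIdeal (S ⧸ P) := by
        rw [← hmap P hPm]
        exact Ideal.mem_map_of_mem _ hx
      have h1 := ringKrullDim_le_ringKrullDim_quotSMulTop_succ hxm
      set J : Ideal (S ⧸ P) := Ideal.Quotient.mk P x • ⊤ with hJ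
      have hxJ : Ideal.Quotient.mk P x ∈ J := by
        rw [hJ, ← Submodule.ideal_span_singleton_smul]
        simp
      let f : S ⧸ Ideal.span {x} →+* (S ⧸ P) ⧸ J :=
        Ideal.Quotient.lift _ ((Ideal.Quotient.mk J).comp (Ideal.Quotient.mk P)) fun a ha => by
          obtain ⟨b, rfl⟩ := Ideal.mem_span_singleton'.1 ha
          simp [Ideal.Quotient.eq_zero_iff_mem.2 hxJ]
      have hf : Function.Surjective f := Ideal.Quotient.lift_surjective_of_surjective _ _
        (Ideal.Quotient.mk_surjective.comp Ideal.Quotient.mk_surjective)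
      have h2 := ringKrullDim_succ_le_of_surjective f hf (r := Ideal.Quotient.mk _ p)
        (mem_nonZeroDivisors_of_ne_zero fun h0 => hpx (Ideal.Quotient.eq_zero_iff_mem.1 h0))
        (by simp [f, Ideal.Quotient.eq_zero_iff_mem.2 hp])
      have h3 := ((hdP.trans h1).trans h2).trans hdimx
      norm_cast at h3
      omega
    -- As P ⊆ (x), x ∉ P and P is prime, P = xP; Nakayama's lemma applies.
    have hPbot : P = ⊥ := by
      refine Submodule.eq_bot_of_le_smul_of_le_jacobson_bot (maximalIdeal S) P
        (IsNoetherian.noetherian P) (fun p hp => ?_) (maximalIdeal_le_jacobson _)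
      obtain ⟨q, rfl⟩ := Ideal.mem_span_singleton'.1 (hPx hp)
      rw [mul_comm]
      exact Submodule.smul_mem_smul hx ((hP.mem_or_mem hp).resolve_right hxP)
    subst hPbot
    have hSdom : IsDomain S := IsDomain.of_bot_isPrime S
    refine ⟨hSdom, (isWeaklyRegular_cons_iff S x t).2 ⟨?_, ?_⟩⟩
    · exact (IsRegular.of_ne_zero (by simpa using hxP)).left.isSMulRegular
    · have h1 := (isWeaklyRegular_map_algebraMap_iff (S ⧸ Ideal.span {x}) (S ⧸ Ideal.span {x}) t).1 hreg
      exact ((Submodule.quotEquivOfEq _ _ hxtop).isWeaklyRegular_congr t).2 h1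

theorem exists_isWeaklyRegular_ofList_eq_maximalIdeal (S : Type*) [CommRing S]
    [IsRegularLocalRing S] :
    ∃ rs : List S, maximalIdeal S = Ideal.ofList rs ∧ IsWeaklyRegular S rs ∧
      ringKrullDim S = rs.length := by
  obtain ⟨s, hs, hspan⟩ := Submodule.FG.exists_span_finset_card_eq_spanFinrank
    (maximalIdeal S).fg_of_isNoetherianRing
  have h1 : maximalIdeal S = Ideal.ofList s.toList := by
    rw [← hspan]
    simp [Ideal.ofList]
  have h2 : ringKrullDim S = s.toList.length := by
    rw [← IsRegularLocalRing.spanFinrank_maximalIdeal, ← hs, Finset.length_toList]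
  exact ⟨s.toList, h1, (isDomain_and_isWeaklyRegular_of_length_le h1 h2.ge).2, h2⟩

end RegularLocal

/-! ### Linear maps out of a quotient ring -/

section CyclicHom

variable {S R : Type*} [CommRing S] [CommRing R] [Algebra S R]

theorem exists_linearMap_apply_one_eq (hsurj : Function.Surjective (algebraMap S R))
    {M : Type*} [AddCommGroup M] [Module S M] (a : M)
    (ha : ∀ s : S, algebraMap S R s = 0 → s • a = 0) :
    ∃ φ : R →ₗ[S] M, ∀ s : S, φ (algebraMap S R s) = s • a := by
  have hwell : ∀ s t : S, algebraMap S R s = algebraMap S R t → s • a = t • a := fun s t h => by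
    rw [← sub_eq_zero, ← sub_smul]
    exact ha _ (by rw [map_sub, h, sub_self])
  refine ⟨⟨⟨fun r => (hsurj r).choose • a, fun x y => ?_⟩, fun s x => ?_⟩,
    fun s => hwell _ _ (hsurj (algebraMap S R s)).choose_spec⟩
  · rw [← add_smul]
    refine hwell _ _ ?_
    rw [map_add, (hsurj _).choose_spec, (hsurj _).choose_spec, (hsurj _).choose_spec]
  · show (hsurj (s • x)).choose • a = s • (hsurj x).choose • a
    rw [smul_smul]
    refine hwell _ _ ?_
    rw [map_mul, (hsurj _).choose_spec, (hsurj _).choose_spec, Algebra.smul_def]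

theorem linearMap_ext_one (hsurj : Function.Surjective (algebraMap S R))
    {M : Type*} [AddCommGroup M] [Module S M] {φ ψ : R →ₗ[S] M} (h : φ 1 = ψ 1) : φ = ψ := by
  ext r
  obtain ⟨s, rfl⟩ := hsurj r
  rw [Algebra.algebraMap_eq_smul_one, map_smul, map_smul, h]

end CyclicHom

/-! ### Socles along surjections of local rings -/

section QuotientSocle

variable {S R : Type*} [CommRing S] [IsLocalRing S] [CommRing R] [IsLocalRing R] [Algebra S R]

theorem algebraMap_mem_maximalIdeal_iff (hsurj : Function.Surjective (algebraMap S R)) (s : S) :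
    algebraMap S R s ∈ maximalIdeal R ↔ s ∈ maximalIdeal S := by
  have := IsLocalHom.of_surjective (algebraMap S R) hsurj
  rw [mem_maximalIdeal, mem_maximalIdeal, mem_nonunits_iff, mem_nonunits_iff,
    isUnit_map_iff]

theorem hasSimpleSocle_iff_of_surjective (hsurj : Function.Surjective (algebraMap S R))
    (M : Type*) [AddCommGroup M] [Module S M] [Module R M] [IsScalarTower S R M] :
    HasSimpleSocle S M ↔ HasSimpleSocle R M := by
  have hkill : ∀ y : M, (∀ a ∈ maximalIdeal S, a • y = 0) ↔ ∀ a ∈ maximalIdeal R, a • y = 0 := by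
    intro y
    constructor
    · intro h a ha
      obtain ⟨s, rfl⟩ := hsurj a
      rw [algebraMap_smul]
      exact h s ((algebraMap_mem_maximalIdeal_iff hsurj s).1 ha)
    · intro h s hs
      rw [← algebraMap_smul R]
      exact h _ ((algebraMap_mem_maximalIdeal_iff hsurj s).2 hs)
  have hspan : ∀ y z : M, (∃ s : S, y = s • z) ↔ ∃ s : R, y = s • z := by
    intro y z
    constructor
    · rintro ⟨s, rfl⟩
      exact ⟨algebraMap S R s, (algebraMap_smul R s z).symm⟩
    · rintro ⟨s, rfl⟩
      obtain ⟨s, rfl⟩ := hsurj s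
      exact ⟨s, algebraMap_smul R s z⟩
  simp only [HasSimpleSocle, hkill, hspan]

/-- Evaluation at 1 identifies Hom(R, M) with the part of M killed by the kernel of S → R, and this
part contains the socle of M. -/
theorem HasSimpleSocle.linearMap (hsurj : Function.Surjective (algebraMap S R))
    {M : Type*} [AddCommGroup M] [Module S M] (h : HasSimpleSocle S M) :
    HasSimpleSocle S (R →ₗ[S] M) := by
  obtain ⟨z, hz0, hmz, hz⟩ := h
  obtain ⟨φ, hφ⟩ := exists_linearMap_apply_one_eq hsurj z fun s hs => hmz s
    ((algebraMap_mem_maximalIdeal_iff hsurj s).1 (by rw [hs]; exact Ideal.zero_mem _))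
  have hφ1 : φ 1 = z := by simpa using hφ 1
  refine ⟨φ, fun h0 => hz0 (by rw [← hφ1, h0, LinearMap.zero_apply]), fun a ha => ?_,
    fun ψ hψ => ?_⟩
  · exact linearMap_ext_one hsurj (by simp [hφ1, hmz a ha])
  · obtain ⟨s, hs⟩ := hz (ψ 1) fun a ha => by rw [← LinearMap.smul_apply, hψ a ha,
      LinearMap.zero_apply]
    exact ⟨s, linearMap_ext_one hsurj (by rw [hs, LinearMap.smul_apply, hφ1])⟩

/-- Hom(k, M) is the socle of M, and Hom(k, k) is generated by the identity. -/
theorem hasSimpleSocle_of_linearEquiv_hom {M : Type*} [AddCommGroup M] [Module S M]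
    (e : (S ⧸ maximalIdeal S →ₗ[S] S ⧸ maximalIdeal S) ≃ₗ[S] (S ⧸ maximalIdeal S →ₗ[S] M)) :
    HasSimpleSocle S M := by
  have hsurj : Function.Surjective (algebraMap S (S ⧸ maximalIdeal S)) :=
    Ideal.Quotient.mk_surjective
  have hnontriv : Nontrivial (S ⧸ maximalIdeal S) :=
    Ideal.Quotient.nontrivial_iff.2 (maximalIdeal.isMaximal S).ne_top
  have hzero : ∀ s : S, algebraMap S (S ⧸ maximalIdeal S) s = 0 ↔ s ∈ maximalIdeal S := fun s =>
    Ideal.Quotient.eq_zero_iff_mem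
  set φ := e LinearMap.id with hφ
  refine ⟨φ 1, fun h0 => ?_, fun a ha => ?_, fun y hy => ?_⟩
  · have h1 : φ = 0 := linearMap_ext_one hsurj h0
    rw [hφ, e.map_eq_zero_iff] at h1
    exact one_ne_zero (LinearMap.congr_fun h1 (1 : S ⧸ maximalIdeal S))
  · rw [← map_smul, ← Algebra.algebraMap_eq_smul_one, (hzero a).2 ha, map_zero]
  · obtain ⟨ψ, hψ⟩ := exists_linearMap_apply_one_eq hsurj y fun s hs => hy s ((hzero s).1 hs)
    obtain ⟨s, hs⟩ := hsurj (e.symm ψ 1)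
    refine ⟨s, ?_⟩
    have h1 : e.symm ψ = s • LinearMap.id := linearMap_ext_one hsurj (by
      rw [← hs, LinearMap.smul_apply, LinearMap.id_apply, Algebra.algebraMap_eq_smul_one])
    rw [LinearEquiv.symm_apply_eq, map_smul] at h1
    have h2 := hψ 1
    rw [map_one, one_smul] at h2
    rw [← h2, h1, LinearMap.smul_apply]

end QuotientSocle

/-! ### Cyclic modules over a self-injective ring -/

section SelfInjective

/-- Over a self-injective ring `A`, a cyclic module `R` with simple socle embeds into `A` onto the
annihilator of its annihilator. -/
theorem exists_generator_annihilator {A R : Type u} [CommRing A] [IsLocalRing A] [CommRing R]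
    [IsLocalRing R] [Algebra A R] (hsurj : Function.Surjective (algebraMap A R))
    (hnil : IsNilpotent (maximalIdeal R)) (hA : Module.Injective A A)
    (hsA : HasSimpleSocle A A) (hsR : HasSimpleSocle R R) :
    ∃ b : A, (∀ s : A, s * b = 0 ↔ algebraMap A R s = 0) ∧
      ∀ a : A, (∀ s : A, algebraMap A R s = 0 → s * a = 0) → ∃ c : A, a = c * b := by
  obtain ⟨zA, hzA0, hmzA, -⟩ := hsA
  obtain ⟨zR, hzR0, hmzR, hzR⟩ := hsR
  -- If ann(x) kills a, then x ↦ a is well defined on A x and extends to M by injectivity of A.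
  have hext : ∀ {M : Type u} [AddCommGroup M] [Module A M] (x : M) (a : A),
      (∀ s : A, s • x = 0 → s * a = 0) → ∃ φ : M →ₗ[A] A, φ x = a := by
    intro M _ _ x a hxa
    let g : (A ⧸ LinearMap.ker (LinearMap.toSpanSingleton A M x)) →ₗ[A] A :=
      Submodule.liftQ _ (LinearMap.toSpanSingleton A A a) fun s hs => hxa s hs
    let f : (A ⧸ LinearMap.ker (LinearMap.toSpanSingleton A M x)) →ₗ[A] M :=
      Submodule.liftQ _ (LinearMap.toSpanSingleton A M x) le_rfl
    have hf : Function.Injective f := by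
      rw [← LinearMap.ker_eq_bot]
      exact Submodule.ker_liftQ_eq_bot _ _ _ le_rfl
    obtain ⟨φ, hφ⟩ := hA.out f hf g
    refine ⟨φ, ?_⟩
    have h1 := hφ (Submodule.Quotient.mk 1)
    have hf1 : f (Submodule.Quotient.mk 1) = x := one_smul A x
    have hg1 : g (Submodule.Quotient.mk 1) = a := one_smul A a
    rw [← hf1, h1, hg1]
  obtain ⟨φ, hφ⟩ := hext zR zA fun s hs => by
    refine hmzA s ?_
    rw [mem_maximalIdeal]
    exact fun hu => hzR0 ((hu.smul_eq_zero).1 hs)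
  -- A nonzero ideal of R contains the socle generator `zR`, and φ(`zR`) = `zA` ≠ 0. So φ is
  -- injective, and b = φ(1) has the annihilator required.
  have hinj : ∀ r : R, (∀ t : R, φ (t * r) = 0) → r = 0 := by
    intro r hr
    by_contra hr0
    have := socle_generator_mem hnil hmzR hzR (K := Ideal.span {r}) (by simpa using hr0)
    obtain ⟨t, ht⟩ := Ideal.mem_span_singleton'.1 this
    exact hzA0 (by rw [← hφ, ← ht, hr])
  have hφs : ∀ s : A, φ (algebraMap A R s) = s * φ 1 := fun s => by
    rw [Algebra.algebraMap_eq_smul_one, map_smul, smul_eq_mul]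
  have hann : ∀ s : A, s * φ 1 = 0 ↔ algebraMap A R s = 0 := by
    intro s
    rw [← hφs]
    constructor
    · intro h
      refine hinj _ fun t => ?_
      obtain ⟨t, rfl⟩ := hsurj t
      rw [← Algebra.smul_def, map_smul, h, smul_zero]
    · intro h
      rw [h, map_zero]
  refine ⟨φ 1, hann, fun a ha => ?_⟩
  obtain ⟨ψ, hψ⟩ := hext (φ 1) a fun s hs => ha s ((hann s).1 hs)
  refine ⟨ψ 1, ?_⟩
  rw [← hψ, mul_comm, ← smul_eq_mul, ← map_smul, smul_eq_mul, mul_one]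

end SelfInjective

/-! ### The dualizing module of an Artinian quotient -/

section Duality

open RingTheory.Sequence Pointwise Abelian

theorem nonempty_ext_linearEquiv_linearMap {S : Type u} [CommRing S] (X : Type u) [AddCommGroup X]
    [Module S X] {rs : List S} (hreg : IsWeaklyRegular S rs) (hann : ∀ r ∈ rs, ∀ x : X, r • x = 0)
    {n : ℕ} (hlen : rs.length = n) :
    Nonempty (Ext (ModuleCat.of S X) (ModuleCat.of S S) n ≃ₗ[S] (X →ₗ[S] S ⧸ Ideal.ofList rs)) := by
  subst hlen
  obtain ⟨-, ⟨e⟩⟩ := ext_of_isWeaklyRegular (ModuleCat.of S X) (ModuleCat.of S S) rs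
    (fun r hr => Module.mem_annihilator.2 (hann r hr)) hreg
  exact ⟨e ≪≫ₗ LinearEquiv.congrRight (Submodule.quotEquivOfEq _ _ (by simp))⟩

theorem nonempty_ext_linearEquiv_iff (S R : Type u) [CommRing S] [IsRegularLocalRing S]
    [CommRing R] [IsLocalRing R] [IsArtinianRing R] [Algebra S R]
    (hsurj : Function.Surjective (algebraMap S R)) {n : ℕ} (hn : ringKrullDim S = n) :
    Nonempty (Ext (ModuleCat.of S R) (ModuleCat.of S S) n ≃ₗ[S] R) ↔ HasSimpleSocle R R := by
  obtain ⟨rs, hrs, hreg, hlen⟩ := exists_isWeaklyRegular_ofList_eq_maximalIdeal S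
  have hlen : rs.length = n := by
    rw [hn] at hlen
    exact_mod_cast hlen.symm
  have hnilR : IsNilpotent (maximalIdeal R) := by
    rw [← isArtinianRing_iff_isNilpotent_maximalIdeal]
    infer_instance
  obtain ⟨N, hN⟩ := hnilR
  have hmem : ∀ r ∈ rs, r ∈ maximalIdeal S := fun r hr => by
    rw [hrs]
    exact Ideal.subset_span hr
  -- N-th powers still form a regular sequence, and they vanish in R since the N-th power of its
  -- maximal ideal is zero.
  have hys := hreg.map_pow N
  set ys := rs.map (· ^ N) with hysdef
  have hyslen : ys.length = n := by rw [hysdef, List.length_map, hlen]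
  have hysR : ∀ y ∈ ys, algebraMap S R y = 0 := by
    intro y hy
    obtain ⟨r, hr, rfl⟩ := List.mem_map.1 hy
    have : algebraMap S R r ^ N ∈ maximalIdeal R ^ N :=
      Ideal.pow_mem_pow ((algebraMap_mem_maximalIdeal_iff hsurj r).2 (hmem r hr)) N
    rw [hN] at this
    rw [map_pow]
    exact this
  have hsurjk : ∀ r ∈ rs, ∀ x : S ⧸ maximalIdeal S, r • x = 0 := fun r hr x => by
    obtain ⟨x, rfl⟩ := Ideal.Quotient.mk_surjective x
    rw [Algebra.smul_def, Ideal.Quotient.algebraMap_eq, ← map_mul, Ideal.Quotient.eq_zero_iff_mem]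
    exact Ideal.mul_mem_right _ _ (hmem r hr)
  have hysk : ∀ y ∈ ys, ∀ x : S ⧸ maximalIdeal S, y • x = 0 := fun y hy x => by
    have hym : y ∈ maximalIdeal S := (algebraMap_mem_maximalIdeal_iff hsurj y).1 (by
      rw [hysR y hy]
      exact Ideal.zero_mem _)
    obtain ⟨x, rfl⟩ := Ideal.Quotient.mk_surjective x
    rw [Algebra.smul_def, Ideal.Quotient.algebraMap_eq, ← map_mul, Ideal.Quotient.eq_zero_iff_mem]
    exact Ideal.mul_mem_right _ _ hym
  obtain ⟨e₁⟩ := nonempty_ext_linearEquiv_linearMap (S ⧸ maximalIdeal S) hreg hsurjk hlen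
  obtain ⟨e₂⟩ := nonempty_ext_linearEquiv_linearMap (S ⧸ maximalIdeal S) hys hysk hyslen
  obtain ⟨e₃⟩ := nonempty_ext_linearEquiv_linearMap R hys (fun y hy x => by
    rw [Algebra.smul_def, hysR y hy, zero_mul]) hyslen
  set J : Ideal S := Ideal.ofList ys with hJ
  -- Both sequences compute Ext^n(k, S), so Hom(k, k) ≅ Hom(k, S/J).
  have hsA : HasSimpleSocle S (S ⧸ J) :=
    hasSimpleSocle_of_linearEquiv_hom
      (LinearEquiv.congrRight (Submodule.quotEquivOfEq _ _ hrs) ≪≫ₗ e₁.symm ≪≫ₗ e₂)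
  have hJker : ∀ s ∈ J, algebraMap S R s = 0 := by
    have : J ≤ RingHom.ker (algebraMap S R) := Ideal.span_le.2 hysR
    exact fun s hs => this hs
  have hJm : J ≤ maximalIdeal S := fun s hs => (algebraMap_mem_maximalIdeal_iff hsurj s).1 (by
    rw [hJker s hs]
    exact Ideal.zero_mem _)
  constructor
  · rintro ⟨e⟩
    rw [← hasSimpleSocle_iff_of_surjective hsurj R]
    exact (hsA.linearMap hsurj).of_linearEquiv (e₃.symm ≪≫ₗ e)
  · intro hsR
    have : Nontrivial (S ⧸ J) := Ideal.Quotient.nontrivial_iff.2 fun htop =>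
      (maximalIdeal.isMaximal S).ne_top (top_le_iff.1 (htop ▸ hJm))
    have hlocal : IsLocalRing (S ⧸ J) :=
      IsLocalRing.of_surjective' (Ideal.Quotient.mk J) Ideal.Quotient.mk_surjective
    have hnilA : IsNilpotent (maximalIdeal (S ⧸ J)) := by
      have hrad : maximalIdeal S ≤ J.radical := by
        rw [hrs]
        refine Ideal.span_le.2 fun r hr => ⟨N, Ideal.subset_span ?_⟩
        exact List.mem_map.2 ⟨r, hr, rfl⟩
      obtain ⟨K, hK⟩ := Ideal.exists_pow_le_of_le_radical_of_fg hrad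
        (maximalIdeal S).fg_of_isNoetherianRing
      refine ⟨K, ?_⟩
      rw [← map_maximalIdeal_of_surjective _ (Ideal.Quotient.mk_surjective (I := J)),
        ← Ideal.map_pow]
      exact Ideal.map_eq_bot_iff_le_ker _ |>.2 (by rwa [Ideal.mk_ker])
    have : IsArtinianRing (S ⧸ J) := (isArtinianRing_iff_isNilpotent_maximalIdeal _).2 hnilA
    have hsA' : HasSimpleSocle (S ⧸ J) (S ⧸ J) :=
      (hasSimpleSocle_iff_of_surjective (S := S) Ideal.Quotient.mk_surjective _).1 hsA
    let : Algebra (S ⧸ J) R := (Ideal.Quotient.lift J (algebraMap S R) hJker).toAlgebra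
    have hmk : ∀ s : S, algebraMap (S ⧸ J) R (Ideal.Quotient.mk J s) = algebraMap S R s :=
      fun s => rfl
    have hsmul : ∀ (s : S) (a : S ⧸ J), s • a = Ideal.Quotient.mk J s * a := fun s a => rfl
    obtain ⟨b, hb, hgen⟩ := exists_generator_annihilator (A := S ⧸ J) (R := R)
      (fun r => by
        obtain ⟨s, rfl⟩ := hsurj r
        exact ⟨Ideal.Quotient.mk J s, hmk s⟩) ⟨N, hN⟩ (injective_of_hasSimpleSocle hsA') hsA' hsR
    have hbs : ∀ s : S, s • b = 0 ↔ algebraMap S R s = 0 := fun s => by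
      rw [hsmul, hb, hmk]
    obtain ⟨φ, hφ⟩ := exists_linearMap_apply_one_eq hsurj b fun s hs => (hbs s).2 hs
    -- φ embeds R in S/J by 1 ↦ b, and Φ sends r to the map t ↦ φ(rt). Surjectivity holds because
    -- ψ(1) is killed by the kernel of S/J → R, so is a multiple of b.
    let Φ : R →ₗ[S] (R →ₗ[S] S ⧸ J) := (LinearMap.mul S R).compr₂ φ
    have hΦ : ∀ r t, Φ r t = φ (r * t) := fun r t => rfl
    have hbij : Function.Bijective Φ := by
      constructor
      · rw [injective_iff_map_eq_zero]
        intro r hr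
        obtain ⟨s, rfl⟩ := hsurj r
        rw [← hbs, ← hφ, ← mul_one (algebraMap S R s), ← hΦ, hr, LinearMap.zero_apply]
      · intro ψ
        obtain ⟨c, hc⟩ := hgen (ψ 1) fun a ha => by
          obtain ⟨s, rfl⟩ := Ideal.Quotient.mk_surjective a
          rw [hmk] at ha
          rw [← hsmul, ← map_smul, ← Algebra.algebraMap_eq_smul_one, ha, map_zero]
        obtain ⟨s, rfl⟩ := Ideal.Quotient.mk_surjective c
        refine ⟨algebraMap S R s, linearMap_ext_one hsurj ?_⟩
        rw [hΦ, mul_one, hφ, hc, hsmul]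
    exact ⟨e₃ ≪≫ₗ (LinearEquiv.ofBijective Φ hbij).symm⟩

end Duality

/-! ### Lifting along square-zero extensions -/

section SquareZero

open Polynomial

/-- A square-zero extension of a field `K` of characteristic `p` by a ring of characteristic `p`
splits. -/
theorem exists_section_of_sq_zero_of_charP {B K : Type*} [CommRing B] [Field K] (p : ℕ)
    [hp : Fact p.Prime] [CharP B p] {f : B →+* K} (hf : Function.Surjective f)
    (hsq : ∀ x y, f x = 0 → f y = 0 → x * y = 0) : ∃ s : K →+* B, f.comp s = RingHom.id K := by
  have : Nontrivial B := hf.nontrivial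
  have : CharP K p := by
    rw [CharP.charP_iff_prime_eq_zero hp.out, ← map_natCast f, CharP.cast_eq_zero, map_zero]
  have hpow0 : ∀ x, f x = 0 → x ^ p = 0 := fun x hx => by
    obtain ⟨m, hm⟩ := Nat.exists_eq_add_of_le hp.out.two_le
    rw [hm, pow_add, sq, hsq x x hx hx, zero_mul]
  -- A maximal subring that contains all p-th powers and meets ker f trivially will map
  -- isomorphically to K. The p-th powers themselves qualify, since x^p = 0 on ker f.
  obtain ⟨C, -, hC⟩ := zorn_le_nonempty₀
    {C : Subring B | (∀ x, x ^ p ∈ C) ∧ ∀ c ∈ C, f c = 0 → c = 0}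
    (by
      intro c hc hch C₀ hC₀
      refine ⟨sSup c, ⟨fun x => ?_, fun x hx => ?_⟩, fun z hz => le_sSup hz⟩
      · exact (le_sSup hC₀ : C₀ ≤ sSup c) ((hc hC₀).1 x)
      · obtain ⟨C₁, hC₁, hx₁⟩ := (Subring.mem_sSup_of_directedOn ⟨C₀, hC₀⟩ hch.directedOn).1 hx
        exact (hc hC₁).2 x hx₁)
    (frobenius B p).range ⟨fun x => ⟨x, rfl⟩, by
      rintro _ ⟨x, rfl⟩ hx
      rw [frobenius_def, map_pow] at hx
      exact hpow0 x (pow_eq_zero_iff hp.out.ne_zero |>.1 hx)⟩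
  obtain ⟨⟨hCpow, hCinj⟩, hCmax⟩ := hC
  let F : Subfield K :=
    { C.map f with
      inv_mem' := by
        rintro _ ⟨x, hx, rfl⟩
        by_cases hx0 : f x = 0
        · exact ⟨0, C.zero_mem, by simp [hx0]⟩
        obtain ⟨y, hy⟩ := hf (f x)⁻¹
        -- The inverse of f(x) is f(x)^(p-1) · (f(x)⁻¹)^p, and C contains all p-th powers.
        refine ⟨x ^ (p - 1) * y ^ p, C.mul_mem (C.pow_mem hx _) (hCpow y), ?_⟩
        rw [map_mul, map_pow, map_pow, hy, inv_pow, ← div_eq_mul_inv, div_eq_iff (pow_ne_zero _ hx0)]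
        obtain ⟨m, hm⟩ := Nat.exists_eq_add_of_le hp.out.one_le
        rw [hm, Nat.add_sub_cancel_left, pow_add, pow_one, inv_mul_cancel_left₀ hx0] }
  have hFmem : ∀ x, x ∈ F ↔ ∃ c ∈ C, f c = x := fun x => Iff.rfl
  have hsurj : ∀ a : K, ∃ c ∈ C, f c = a := by
    intro a
    by_contra ha
    rw [← hFmem] at ha
    obtain ⟨b, rfl⟩ := hf a
    let φ : C →+* F := f.restrict C F.toSubring fun c hc => (hFmem _).2 ⟨c, hc, rfl⟩
    have hφ : ∀ c, (φ c : K) = f c := fun c => rfl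
    let q₀ : C[X] := X ^ p - Polynomial.C ⟨b ^ p, hCpow b⟩
    have hq₀ : q₀.Monic := monic_X_pow_sub_C _ hp.out.ne_zero
    have hirr : Irreducible (q₀.map φ) := by
      have : q₀.map φ = X ^ p - Polynomial.C (φ ⟨b ^ p, hCpow b⟩) := by simp [q₀]
      rw [this]
      -- By injectivity of Frobenius the only possible root is f(b), which is not in F.
      refine X_pow_sub_C_irreducible_of_prime hp.out fun y hy => ha ?_
      have h1 : (y : K) ^ p = f b ^ p := by
        rw [← map_pow]
        exact congrArg Subtype.val hy
      have h2 : (y : K) = f b := frobenius_inj K p h1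
      exact h2 ▸ y.2
    have heval : ∀ q : C[X], f (q.eval₂ C.subtype b) = (q.map φ).eval₂ F.subtype (f b) := fun q => by
      rw [eval₂_map, hom_eval₂]
      rfl
    have hle : C ≤ (eval₂RingHom C.subtype b).range := fun c hc =>
      ⟨Polynomial.C ⟨c, hc⟩, by simp⟩
    have hmem := hCmax (y := (eval₂RingHom C.subtype b).range) ⟨fun x => hle (hCpow x), by
      rintro _ ⟨q, rfl⟩ hq
      rw [coe_eval₂RingHom] at hq ⊢
      have hq₀b : q₀.eval₂ C.subtype b = 0 := by simp [q₀]
      have hmod : q.eval₂ C.subtype b = (q %ₘ q₀).eval₂ C.subtype b := by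
        conv_lhs => rw [← modByMonic_add_div q q₀]
        rw [eval₂_add, eval₂_mul, hq₀b, zero_mul, add_zero]
      rw [hmod] at hq ⊢
      rw [heval] at hq
      -- The reduced `q₀` is the minimal polynomial of f(b), and the remainder has smaller degree.
      -- It is therefore zero over F, and zero over C because φ is injective.
      have hdvd : q₀.map φ ∣ (q %ₘ q₀).map φ := by
        have h0 : (q₀.map φ).eval₂ F.subtype (f b) = 0 := by rw [← heval, hq₀b, map_zero]
        have h1 := minpoly.eq_of_irreducible_of_monic (A := F) (x := f b) hirr h0 (hq₀.map φ)
        rw [h1]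
        exact minpoly.dvd F (f b) hq
      have hzero : (q %ₘ q₀).map φ = 0 := by
        by_contra hne
        have h1 := degree_le_of_dvd hdvd hne
        rw [hq₀.degree_map] at h1
        exact absurd (degree_modByMonic_lt q hq₀)
          (not_lt.2 (h1.trans degree_map_le))
      have : q %ₘ q₀ = 0 := by
        ext i
        have h1 : φ ((q %ₘ q₀).coeff i) = 0 := by rw [← coeff_map, hzero, coeff_zero]
        rw [coeff_zero, ZeroMemClass.coe_zero]
        exact hCinj _ ((q %ₘ q₀).coeff i).2 (congrArg Subtype.val h1)
      rw [this, eval₂_zero]⟩ hle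
    exact ha ((hFmem _).2 ⟨b, hmem ⟨X, by simp⟩, rfl⟩)
  let e : C ≃+* K := RingEquiv.ofBijective (f.comp C.subtype) ⟨by
    rw [injective_iff_map_eq_zero]
    exact fun c hc => Subtype.ext (hCinj c c.2 hc), fun a => by
    obtain ⟨c, hc, rfl⟩ := hsurj a
    exact ⟨⟨c, hc⟩, rfl⟩⟩
  exact ⟨C.subtype.comp e.symm.toRingHom, RingHom.ext fun a => e.apply_symm_apply a⟩

/-- A ring `V` without `p`-torsion such that `V / p` is a field lifts along square-zero extensions
whose kernel is killed by `p`. -/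
theorem exists_lift_of_sq_zero {V A A' K : Type*} [CommRing V] [CommRing A] [CommRing A'] [Field K]
    (p : ℕ) [hp : Fact p.Prime] {f : V →+* K} (hf : Function.Surjective f)
    (hker : ∀ v, f v = 0 ↔ (p : V) ∣ v) (htors : ∀ v : V, (p : V) * v = 0 → v = 0)
    {g : A →+* A'} (hg : Function.Surjective g) (hsq : ∀ x y, g x = 0 → g y = 0 → x * y = 0)
    (hpg : ∀ x, g x = 0 → (p : A) * x = 0) (φ : V →+* A') : ∃ ψ : V →+* A, g.comp ψ = φ := by
  -- B is the fibre product of V and A over A'. The kernel of B/p → K is represented by pairs (0, a)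
  -- with g(a) = 0, so has square zero, and B/p → K has a section s.
  let B : Subring (V × A) := (φ.comp (RingHom.fst V A)).eqLocus (g.comp (RingHom.snd V A))
  have hB : ∀ x : V × A, x ∈ B ↔ φ x.1 = g x.2 := fun x => Iff.rfl
  let I : Ideal B := Ideal.span {(p : B)}
  let π : B →+* V := (RingHom.fst V A).comp B.subtype
  let fbar : B ⧸ I →+* K := Ideal.Quotient.lift I (f.comp π) fun b hb => by
    obtain ⟨c, rfl⟩ := Ideal.mem_span_singleton'.1 hb
    rw [map_mul, map_natCast, RingHom.comp_apply]
    rw [← map_natCast f p, (hker _).2 dvd_rfl, mul_zero]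
  have hfbar : ∀ b : B, fbar (Ideal.Quotient.mk I b) = f b.1.1 := fun b => rfl
  have hπ : Function.Surjective π := fun v => by
    obtain ⟨a, ha⟩ := hg (φ v)
    exact ⟨⟨(v, a), ha.symm⟩, rfl⟩
  have hrep : ∀ x, fbar x = 0 → ∃ b : B, b.1.1 = 0 ∧ Ideal.Quotient.mk I b = x := by
    intro x hx
    obtain ⟨b, rfl⟩ := Ideal.Quotient.mk_surjective x
    rw [hfbar, hker] at hx
    obtain ⟨w, hw⟩ := hx
    obtain ⟨c, rfl⟩ := hπ w
    refine ⟨b - p * c, ?_, ?_⟩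
    · show b.1.1 - (p : V) * c.1.1 = 0
      rw [hw]
      exact sub_self _
    · rw [map_sub, sub_eq_self, Ideal.Quotient.eq_zero_iff_mem]
      exact Ideal.mul_mem_right _ _ (Ideal.mem_span_singleton_self _)
  have hzero : ∀ b : B, b.1.1 = 0 → g b.1.2 = 0 := fun b hb => by
    rw [← (hB b.1).1 b.2, hb, map_zero]
  have hfs : Function.Surjective fbar := fun a => by
    obtain ⟨v, rfl⟩ := hf a
    obtain ⟨b, rfl⟩ := hπ v
    exact ⟨Ideal.Quotient.mk I b, rfl⟩
  have : Nontrivial (B ⧸ I) := hfs.nontrivial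
  have : CharP (B ⧸ I) p := by
    refine (CharP.charP_iff_prime_eq_zero hp.out).2 ?_
    rw [← map_natCast (Ideal.Quotient.mk I), Ideal.Quotient.eq_zero_iff_mem]
    exact Ideal.mem_span_singleton_self _
  obtain ⟨s, hs⟩ := exists_section_of_sq_zero_of_charP p hfs fun x y hx hy => by
    obtain ⟨b, hb, rfl⟩ := hrep x hx
    obtain ⟨c, hc, rfl⟩ := hrep y hy
    have : b * c = 0 := Subtype.ext (Prod.ext (by simp [hb])
      (hsq _ _ (hzero b hb) (hzero c hc)))
    rw [← map_mul, this, map_zero]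
  have hs' : ∀ a, fbar (s a) = a := fun a => RingHom.congr_fun hs a
  -- B' is the preimage of s(K) in B, and its projection to V is bijective. For injectivity, a pair
  -- (0, a) in B' is p(c, a') with pc = 0; then c = 0, g(a') = 0 and a = pa' = 0.
  let B' : Subring B := (Ideal.Quotient.mk I).eqLocus ((s.comp f).comp π)
  have hB' : ∀ b : B, b ∈ B' ↔ Ideal.Quotient.mk I b = s (f b.1.1) := fun b => Iff.rfl
  let e : B' ≃+* V := RingEquiv.ofBijective (π.comp B'.subtype) ⟨by
    rw [injective_iff_map_eq_zero]
    rintro ⟨b, hb⟩ hb0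
    have hb0 : b.1.1 = 0 := hb0
    rw [hB', hb0, map_zero, map_zero, Ideal.Quotient.eq_zero_iff_mem] at hb
    obtain ⟨c, rfl⟩ := Ideal.mem_span_singleton.1 hb
    have hc : c.1.1 = 0 := htors _ hb0
    refine Subtype.ext (Subtype.ext (Prod.ext hb0 ?_))
    exact hpg _ (hzero c hc), fun v => by
    obtain ⟨b, rfl⟩ := hπ v
    obtain ⟨c, hc, hcb⟩ := hrep (Ideal.Quotient.mk I b - s (f (π b))) (by
      rw [map_sub, hs', hfbar]
      exact sub_self _)
    have hbc : π (b - c) = π b := by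
      rw [map_sub, sub_eq_self]
      exact hc
    refine ⟨⟨b - c, ?_⟩, hbc⟩
    show Ideal.Quotient.mk I (b - c) = s (f (π (b - c)))
    rw [hbc, map_sub, hcb, sub_sub_cancel]⟩
  refine ⟨(RingHom.snd V A).comp (B.subtype.comp (B'.subtype.comp e.symm.toRingHom)),
    RingHom.ext fun v => ?_⟩
  have h1 := (hB _).1 (e.symm v).1.2
  have h2 : (e.symm v).1.1.1 = v := e.apply_symm_apply v
  rw [h2] at h1
  exact h1.symm

/-- A ring `V` without `p`-torsion such that `V / p` is the residue field of a local ring `R` with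
nilpotent maximal ideal maps to `R` over the residue field. -/
theorem exists_lift_residue {V R : Type*} [CommRing V] [CommRing R] [IsLocalRing R]
    (hnil : IsNilpotent (maximalIdeal R)) (p : ℕ) [hp : Fact p.Prime] [CharP (ResidueField R) p]
    {f : V →+* ResidueField R} (hf : Function.Surjective f)
    (hker : ∀ v, f v = 0 ↔ (p : V) ∣ v) (htors : ∀ v : V, (p : V) * v = 0 → v = 0) :
    ∃ ψ : V →+* R, (residue R).comp ψ = f := by
  have hpm : (p : R) ∈ maximalIdeal R := by
    rw [← residue_eq_zero_iff, map_natCast, CharP.cast_eq_zero]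
  have hlift : ∀ n : ℕ, ∃ ψ : V →+* R ⧸ maximalIdeal R ^ (n + 1),
      ∀ v r, Ideal.Quotient.mk _ r = ψ v → residue R r = f v := by
    intro n
    induction n with
    | zero =>
      let e : ResidueField R →+* R ⧸ maximalIdeal R ^ (0 + 1) :=
        Ideal.Quotient.lift (maximalIdeal R) (Ideal.Quotient.mk _) fun a ha =>
          Ideal.Quotient.eq_zero_iff_mem.2 (by rwa [zero_add, pow_one])
      have he : ∀ r, e (residue R r) = Ideal.Quotient.mk _ r := fun r => rfl
      refine ⟨e.comp f, fun v r h => ?_⟩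
      obtain ⟨r', hr'⟩ := residue_surjective (f v)
      rw [RingHom.comp_apply, ← hr', he, Ideal.Quotient.eq, zero_add, pow_one] at h
      rw [← hr', ← sub_eq_zero, ← map_sub, residue_eq_zero_iff]
      exact h
    | succ n ih =>
      obtain ⟨φ, hφ⟩ := ih
      have hle : maximalIdeal R ^ (n + 1 + 1) ≤ maximalIdeal R ^ (n + 1) :=
        Ideal.pow_le_pow_right (Nat.le_succ _)
      have hzero : ∀ r, Ideal.Quotient.factor hle (Ideal.Quotient.mk _ r) = 0 ↔
          r ∈ maximalIdeal R ^ (n + 1) := fun r => by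
        rw [Ideal.Quotient.factor_mk, Ideal.Quotient.eq_zero_iff_mem]
      -- The kernel m^(n+1)/m^(n+2) has square zero since 2(n + 1) ≥ n + 2, and p kills it since p ∈
      -- m.
      obtain ⟨ψ, hψ⟩ := exists_lift_of_sq_zero p hf hker htors
        (Ideal.Quotient.factor_surjective hle) (fun x y hx hy => by
          obtain ⟨x, rfl⟩ := Ideal.Quotient.mk_surjective x
          obtain ⟨y, rfl⟩ := Ideal.Quotient.mk_surjective y
          rw [hzero] at hx hy
          rw [← map_mul, Ideal.Quotient.eq_zero_iff_mem]
          have := Ideal.mul_mem_mul hx hy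
          rw [← pow_add] at this
          exact Ideal.pow_le_pow_right (by omega) this) (fun x hx => by
          obtain ⟨x, rfl⟩ := Ideal.Quotient.mk_surjective x
          rw [hzero] at hx
          rw [← map_natCast (Ideal.Quotient.mk _), ← map_mul, Ideal.Quotient.eq_zero_iff_mem,
            pow_succ']
          exact Ideal.mul_mem_mul hpm hx) φ
      refine ⟨ψ, fun v r hr => hφ v r ?_⟩
      rw [← hψ, RingHom.comp_apply, ← hr, Ideal.Quotient.factor_mk]
  obtain ⟨N, hN⟩ := hnil
  obtain ⟨ψ, hψ⟩ := hlift N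
  have hbot : maximalIdeal R ^ (N + 1) = ⊥ := by rw [pow_succ, hN, zero_mul]; rfl
  let e : R ⧸ maximalIdeal R ^ (N + 1) ≃+* R :=
    (Ideal.quotEquivOfEq hbot).trans (RingEquiv.quotientBot R)
  refine ⟨e.toRingHom.comp ψ, RingHom.ext fun v => hψ v _ ?_⟩
  obtain ⟨r, hr⟩ := Ideal.Quotient.mk_surjective (ψ v)
  have : e (ψ v) = r := by rw [← hr]; rfl
  rw [← hr]
  exact congrArg _ this

end SquareZero

/-! ### Subrings with prescribed residue field -/

section CohenRing

open Polynomial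

/-- Suppose that `O` is a local ring with residue field `κ` of characteristic `p`, in which every
root in `κ` of a monic polynomial lifts to a root. Then every subfield `k` of `κ` is the residue
field of a local subring of `O` whose maximal ideal is generated by `p`. -/
theorem exists_subring_of_root_lifting {O κ : Type*} [CommRing O] [Field κ] (p : ℕ) [CharP κ p]
    {res : O →+* κ} (hres : Function.Surjective res) (hunit : ∀ x, res x ≠ 0 → IsUnit x)
    (hroot : ∀ q : O[X], q.Monic → ∀ a, q.eval₂ res a = 0 → ∃ t, res t = a ∧ q.eval t = 0)
    (k : Subfield κ) :
    ∃ V : Subring O, (∀ v ∈ V, res v = 0 → ∃ w ∈ V, v = p * w) ∧ (∀ v ∈ V, res v ∈ k) ∧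
      (∀ a ∈ k, ∃ v ∈ V, res v = a) ∧ ∀ v ∈ V, res v ≠ 0 → ∃ w ∈ V, v * w = 1 := by
  obtain ⟨V, -, hV⟩ := zorn_le_nonempty₀
    {V : Subring O | (∀ v ∈ V, res v = 0 → ∃ w ∈ V, v = p * w) ∧ ∀ v ∈ V, res v ∈ k}
    (by
      intro c hc hch C₀ hC₀
      have hmem : ∀ {x}, x ∈ sSup c ↔ ∃ C ∈ c, x ∈ C :=
        Subring.mem_sSup_of_directedOn ⟨C₀, hC₀⟩ hch.directedOn
      refine ⟨sSup c, ⟨fun x hx hx0 => ?_, fun x hx => ?_⟩, fun z hz => le_sSup hz⟩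
      · obtain ⟨C₁, hC₁, hx₁⟩ := hmem.1 hx
        obtain ⟨w, hw, h⟩ := (hc hC₁).1 x hx₁ hx0
        exact ⟨w, hmem.2 ⟨C₁, hC₁, hw⟩, h⟩
      · obtain ⟨C₁, hC₁, hx₁⟩ := hmem.1 hx
        exact (hc hC₁).2 x hx₁)
    ⊥ ⟨by
      intro v hv hv0
      obtain ⟨n, rfl⟩ := Subring.mem_bot.1 hv
      rw [map_intCast, CharP.intCast_eq_zero_iff κ p] at hv0
      obtain ⟨m, rfl⟩ := hv0
      exact ⟨m, intCast_mem _ m, by push_cast; rfl⟩, by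
      intro v hv
      obtain ⟨n, rfl⟩ := Subring.mem_bot.1 hv
      rw [map_intCast]
      exact intCast_mem k n⟩
  obtain ⟨⟨hVp, hVk⟩, hVmax⟩ := hV
  have hinv : ∀ v ∈ V, res v ≠ 0 → ∃ w ∈ V, v * w = 1 := by
    -- W is the localization of V at the elements with nonzero residue. It has the same two
    -- properties, so maximality gives W = V.
    let W : Subring O :=
      { carrier := {x | ∃ v ∈ V, ∃ w ∈ V, res w ≠ 0 ∧ x * w = v}
        mul_mem' := by
          rintro x y ⟨v, hv, w, hw, hw0, h⟩ ⟨v', hv', w', hw', hw0', h'⟩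
          refine ⟨v * v', V.mul_mem hv hv', w * w', V.mul_mem hw hw', ?_, ?_⟩
          · rw [map_mul]
            exact mul_ne_zero hw0 hw0'
          · rw [← h, ← h']
            ring
        one_mem' := ⟨1, V.one_mem, 1, V.one_mem, by simp, by simp⟩
        add_mem' := by
          rintro x y ⟨v, hv, w, hw, hw0, h⟩ ⟨v', hv', w', hw', hw0', h'⟩
          refine ⟨v * w' + v' * w, V.add_mem (V.mul_mem hv hw') (V.mul_mem hv' hw), w * w',
            V.mul_mem hw hw', ?_, ?_⟩
          · rw [map_mul]
            exact mul_ne_zero hw0 hw0'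
          · rw [← h, ← h']
            ring
        zero_mem' := ⟨0, V.zero_mem, 1, V.one_mem, by simp, by simp⟩
        neg_mem' := by
          rintro x ⟨v, hv, w, hw, hw0, h⟩
          exact ⟨-v, V.neg_mem hv, w, hw, hw0, by rw [← h, neg_mul]⟩ }
    have hle : V ≤ W := fun v hv => ⟨v, hv, 1, V.one_mem, by simp, by simp⟩
    have hWV : W ≤ V := by
      refine hVmax ⟨?_, ?_⟩ hle
      · rintro x ⟨v, hv, w, hw, hw0, h⟩ hx
        obtain ⟨u, hu, rfl⟩ := hVp v hv (by rw [← h, map_mul, hx, zero_mul])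
        obtain ⟨y, hy⟩ := (hunit w hw0).exists_right_inv
        refine ⟨u * y, ⟨u, hu, w, hw, hw0, by rw [mul_assoc, mul_comm y, hy, mul_one]⟩, ?_⟩
        rw [← mul_assoc, ← h, mul_assoc, hy, mul_one]
      · rintro x ⟨v, hv, w, hw, hw0, h⟩
        have : res x = res v / res w := by rw [eq_div_iff hw0, ← map_mul, h]
        rw [this]
        exact k.div_mem (hVk v hv) (hVk w hw)
    intro v hv hv0
    obtain ⟨w, hw⟩ := (hunit v hv0).exists_right_inv
    exact ⟨w, hWV ⟨1, V.one_mem, v, hv, hv0, by rw [mul_comm, hw]⟩, hw⟩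
  let F : Subfield κ :=
    { V.map res with
      inv_mem' := by
        rintro _ ⟨x, hx, rfl⟩
        by_cases hx0 : res x = 0
        · exact ⟨0, V.zero_mem, by simp [hx0]⟩
        obtain ⟨y, hy, hxy⟩ := hinv x hx hx0
        refine ⟨y, hy, eq_inv_of_mul_eq_one_right ?_⟩
        rw [← map_mul, hxy, map_one] }
  have hFmem : ∀ x, x ∈ F ↔ ∃ c ∈ V, res c = x := fun x => Iff.rfl
  refine ⟨V, hVp, hVk, fun a hak => ?_, hinv⟩
  by_contra ha
  rw [← hFmem] at ha
  let φ : V →+* F := res.restrict V F.toSubring fun c hc => (hFmem _).2 ⟨c, hc, rfl⟩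
  have hφs : Function.Surjective φ := by
    rintro ⟨x, hx⟩
    obtain ⟨c, hc, rfl⟩ := (hFmem x).1 hx
    exact ⟨⟨c, hc⟩, rfl⟩
  have hφp : ∀ q : V[X], q.map φ = 0 → ∃ q' : V[X], q = Polynomial.C (p : V) * q' := by
    intro q hq
    have hcoef : ∀ i, (p : V) ∣ q.coeff i := fun i => by
      have h1 : φ (q.coeff i) = 0 := by rw [← coeff_map, hq, coeff_zero]
      obtain ⟨w, hw, h⟩ := hVp (q.coeff i) (q.coeff i).2 (congrArg Subtype.val h1)
      exact ⟨⟨w, hw⟩, Subtype.ext h⟩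
    exact C_dvd_iff_dvd_coeff _ _ |>.2 hcoef
  -- A lift t of a for which every relation of a over F comes from a value in p V[t]. If a is
  -- integral, t is a root of a monic lift of its minimal polynomial, and remainders modulo that
  -- lift are tested; otherwise only the zero polynomial vanishes at a, and any lift serves. Then
  -- V[t] contradicts maximality.
  have key : ∃ t : O, res t = a ∧ ∀ q : V[X], (q.map φ).eval₂ F.subtype a = 0 →
      ∃ q' : V[X], q.eval₂ V.subtype t = p * q'.eval₂ V.subtype t := by
    have hdiv : ∀ (t : O) (q : V[X]), q.map φ = 0 →
        ∃ q' : V[X], q.eval₂ V.subtype t = p * q'.eval₂ V.subtype t := fun t q hq => by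
      obtain ⟨q', rfl⟩ := hφp q hq
      exact ⟨q', by simp⟩
    by_cases halg : IsIntegral F a
    · obtain ⟨q₀, hq₀, hdeg, hmonic⟩ := lifts_and_natDegree_eq_and_monic
        ((mem_lifts _).2 (map_surjective φ hφs (minpoly F a))) (minpoly.monic halg)
      have hq₀a : (q₀.map φ).eval₂ F.subtype a = 0 := by
        rw [hq₀]
        exact minpoly.aeval F a
      obtain ⟨t, ht, ht0⟩ := hroot (q₀.map V.subtype) (hmonic.map _) a (by
        rw [eval₂_map] at hq₀a ⊢
        exact hq₀a)
      rw [Polynomial.eval_map] at ht0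
      refine ⟨t, ht, fun q hq => ?_⟩
      have hmod : ∀ {T : Type _} [CommRing T] (h : V →+* T) (y : T), q₀.eval₂ h y = 0 →
          q.eval₂ h y = (q %ₘ q₀).eval₂ h y := fun h y hy => by
        conv_lhs => rw [← modByMonic_add_div q q₀]
        rw [eval₂_add, eval₂_mul, hy, zero_mul, add_zero]
      rw [hmod _ _ ht0]
      refine hdiv t _ ?_
      by_contra hne
      have h1 : ((q %ₘ q₀).map φ).eval₂ F.subtype a = 0 := by
        rw [eval₂_map] at hq hq₀a ⊢
        conv_lhs at hq => rw [← modByMonic_add_div q q₀]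
        rwa [eval₂_add, eval₂_mul, hq₀a, zero_mul, add_zero] at hq
      have h2 := minpoly.degree_le_of_ne_zero F a hne h1
      rw [← hq₀, hmonic.degree_map] at h2
      have := hφs.nontrivial
      exact absurd (degree_modByMonic_lt q hmonic) (not_lt.2 (h2.trans degree_map_le))
    · obtain ⟨t, ht⟩ := hres a
      refine ⟨t, ht, fun q hq => hdiv t q ?_⟩
      by_contra hne
      exact halg (isAlgebraic_iff_isIntegral.1 ⟨q.map φ, hne, hq⟩)
  obtain ⟨t, rfl, ht⟩ := key
  have heval : ∀ q : V[X],
      res (q.eval₂ V.subtype t) = (q.map φ).eval₂ F.subtype (res t) := fun q => by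
    rw [eval₂_map, hom_eval₂]
    rfl
  have hFk : ∀ x : F, (x : κ) ∈ k := by
    rintro ⟨x, hx⟩
    obtain ⟨c, hc, rfl⟩ := (hFmem x).1 hx
    exact hVk c hc
  have hle : V ≤ (eval₂RingHom V.subtype t).range := fun c hc =>
    ⟨Polynomial.C ⟨c, hc⟩, by simp⟩
  have hmem := hVmax (y := (eval₂RingHom V.subtype t).range) ⟨by
    rintro _ ⟨q, rfl⟩ hq
    rw [coe_eval₂RingHom, heval] at hq
    obtain ⟨q', hq'⟩ := ht q hq
    exact ⟨_, ⟨q', rfl⟩, hq'⟩, by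
    rintro _ ⟨q, rfl⟩
    rw [coe_eval₂RingHom, heval, eval₂_eq_sum]
    exact k.sum_mem fun i _ => k.mul_mem (hFk _) (k.pow_mem hak i)⟩ hle
  exact ha ((hFmem _).2 ⟨t, hmem ⟨X, by simp⟩, rfl⟩)

/-- Roots of monic polynomials lift along the residue map of a valuation ring of an algebraically
closed field. -/
theorem ValuationSubring.exists_root_lift {Ω : Type*} [Field Ω] [IsAlgClosed Ω]
    (O : ValuationSubring Ω) (q : O[X]) (hq : q.Monic) (a : ResidueField O)
    (ha : q.eval₂ (residue O) a = 0) : ∃ t, residue O t = a ∧ q.eval t = 0 := by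
  generalize hn : q.natDegree = n
  induction n generalizing q with
  | zero =>
    rw [hq.natDegree_eq_zero.1 hn, eval₂_one] at ha
    exact absurd ha one_ne_zero
  | succ n ih =>
    obtain ⟨x, hx⟩ := IsAlgClosed.exists_root (q.map (algebraMap O Ω)) (by
      rw [hq.degree_map, degree_eq_natDegree hq.ne_zero, hn]
      exact_mod_cast n.succ_ne_zero)
    rw [IsRoot, Polynomial.eval_map] at hx
    -- The root is integral over O, hence in O. Splitting off X - t, either a is the residue of t or
    -- a is a root of the reduced cofactor.
    obtain ⟨t, rfl⟩ := IsIntegrallyClosed.isIntegral_iff.1 (⟨q, hq, hx⟩ : IsIntegral O x)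
    have ht : q.IsRoot t := by
      rw [eval₂_at_apply] at hx
      exact (map_eq_zero_iff _ (IsFractionRing.injective O Ω)).1 hx
    obtain ⟨g, rfl⟩ := dvd_iff_isRoot.2 ht
    have hg : g.Monic := (monic_X_sub_C t).of_mul_monic_left hq
    rw [eval₂_mul, mul_eq_zero] at ha
    rcases ha with ha | ha
    · refine ⟨t, ?_, ht⟩
      rw [eval₂_sub, eval₂_X, eval₂_C, sub_eq_zero] at ha
      exact ha.symm
    · obtain ⟨s, hs, hs0⟩ := ih g hg ha (by
        rw [(monic_X_sub_C t).natDegree_mul hg, natDegree_X_sub_C] at hn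
        omega)
      exact ⟨s, hs, by rw [eval_mul, hs0, mul_zero]⟩

end CohenRing

/-! ### Existence of principal ideal domains with given residue field -/

section CohenRingExists

/-- If `V` is a local domain with maximal ideal `(p)`, then the quotient of `V` by the intersection
of the powers of `p` is a discrete valuation ring with the same residue field. -/
theorem exists_discreteValuationRing_quotient {V K : Type u} [CommRing V] [IsDomain V] [Field K]
    {f : V →+* K} (hf : Function.Surjective f) {p : ℕ} (hp0 : (p : V) ≠ 0)
    (hker : ∀ v, f v = 0 ↔ (p : V) ∣ v) (hunit : ∀ v, f v ≠ 0 → IsUnit v) :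
    ∃ (W : Type u) (_ : CommRing W) (_ : IsDomain W) (_ : IsPrincipalIdealRing W) (g : W →+* K),
      Function.Surjective g ∧ (∀ w, g w = 0 ↔ (p : W) ∣ w) ∧ (p : W) ≠ 0 := by
  have hp1 : ∀ u : V, IsUnit u → ¬ (p : V) ∣ u := fun u hu h =>
    (hu.map f).ne_zero ((hker u).2 h)
  let N : Ideal V := ⨅ n : ℕ, Ideal.span {(p : V) ^ n}
  have hN : ∀ v, v ∈ N ↔ ∀ n : ℕ, (p : V) ^ n ∣ v := fun v => by
    simp only [N, Submodule.mem_iInf, Ideal.mem_span_singleton]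
  -- Outside N every element is a power of p times a unit. This makes N prime and V/N a discrete
  -- valuation ring.
  have hfac : ∀ v, v ∉ N → ∃ (n : ℕ) (u : V), IsUnit u ∧ v = (p : V) ^ n * u := by
    intro v hv
    rw [hN] at hv
    push Not at hv
    classical
    obtain ⟨n, hn⟩ : ∃ n, Nat.find hv = n := ⟨_, rfl⟩
    have hspec := Nat.find_spec hv
    rw [hn] at hspec
    cases n with
    | zero => exact absurd (by simp) hspec
    | succ n =>
      have := Nat.find_min hv (m := n) (by omega)
      push Not at this
      obtain ⟨u, rfl⟩ := this
      refine ⟨n, u, hunit u fun hu => hspec ?_, rfl⟩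
      rw [pow_succ]
      exact mul_dvd_mul_left _ ((hker u).1 hu)
  have hNprime : N.IsPrime := by
    refine ⟨fun h => ?_, fun {x y} hxy => ?_⟩
    · have h1 : (1 : V) ∈ N := h ▸ Submodule.mem_top
      exact hp1 1 isUnit_one (by simpa using (hN 1).1 h1 1)
    · by_contra hcon
      push Not at hcon
      obtain ⟨a, u, hu, rfl⟩ := hfac x hcon.1
      obtain ⟨b, w, hw, rfl⟩ := hfac y hcon.2
      have h1 := (hN _).1 hxy (a + b + 1)
      rw [mul_mul_mul_comm, ← pow_add, pow_succ] at h1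
      exact hp1 _ (hu.mul hw) ((mul_dvd_mul_iff_left (pow_ne_zero _ hp0)).1 h1)
  let g : V ⧸ N →+* K := Ideal.Quotient.lift N f fun v hv =>
    (hker v).2 (by simpa using (hN v).1 hv 1)
  have hg : ∀ v, g (Ideal.Quotient.mk N v) = f v := fun v => rfl
  have hpmk : Ideal.Quotient.mk N (p : V) = (p : V ⧸ N) := map_natCast _ p
  have hgker : ∀ w, g w = 0 ↔ (p : V ⧸ N) ∣ w := fun w => by
    obtain ⟨v, rfl⟩ := Ideal.Quotient.mk_surjective w
    constructor
    · intro h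
      rw [← hpmk]
      exact map_dvd _ ((hker v).1 h)
    · rintro ⟨c, hc⟩
      rw [hc, map_mul, ← hpmk, hg, (hker _).2 dvd_rfl, zero_mul]
  have hp0' : (p : V ⧸ N) ≠ 0 := by
    rw [← hpmk, Ne, Ideal.Quotient.eq_zero_iff_mem, hN]
    intro h
    have h1 := h 2
    rw [pow_two] at h1
    nth_rw 3 [← mul_one (p : V)] at h1
    exact hp1 1 isUnit_one ((mul_dvd_mul_iff_left hp0).1 h1)
  have hprime : Prime (p : V ⧸ N) := by
    refine ⟨hp0', fun h => ?_, fun a b h => ?_⟩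
    · exact (h.map g).ne_zero ((hgker _).2 dvd_rfl)
    · rw [← hgker, map_mul, mul_eq_zero] at h
      rwa [← hgker, ← hgker]
  have hdvr : IsDiscreteValuationRing (V ⧸ N) := by
    refine IsDiscreteValuationRing.ofHasUnitMulPowIrreducibleFactorization
      ⟨p, hprime.irreducible, fun {x} hx => ?_⟩
    obtain ⟨v, rfl⟩ := Ideal.Quotient.mk_surjective x
    obtain ⟨n, u, hu, rfl⟩ := hfac v fun h => hx (Ideal.Quotient.eq_zero_iff_mem.2 h)
    refine ⟨n, (hu.map (Ideal.Quotient.mk N)).unit, ?_⟩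
    rw [map_mul, map_pow, hpmk, IsUnit.unit_spec]
  refine ⟨V ⧸ N, inferInstance, inferInstance, inferInstance, g, fun a => ?_, hgker, hp0'⟩
  obtain ⟨v, rfl⟩ := hf a
  exact ⟨Ideal.Quotient.mk N v, rfl⟩

/-- Every field embeds in the residue field of a valuation ring of an algebraically closed field of
characteristic zero. -/
theorem exists_valuationSubring_residueField (K : Type u) [Field K] :
    ∃ (Ω : Type u) (_ : Field Ω) (_ : IsAlgClosed Ω) (_ : CharZero Ω) (O : ValuationSubring Ω),
      Nonempty (K →+* ResidueField O) := by
  -- One variable for each element of K, sent to that element, so that K is a quotient of a domain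
  -- of characteristic zero.
  let P := MvPolynomial K ℤ
  let π : P →+* K := (MvPolynomial.aeval (R := ℤ) (id : K → K)).toRingHom
  have hπ : Function.Surjective π := fun a => ⟨MvPolynomial.X a, MvPolynomial.aeval_X _ _⟩
  let 𝔭 : Ideal P := RingHom.ker π
  have h𝔭 : 𝔭.IsPrime := RingHom.ker_isPrime π
  let Ω := AlgebraicClosure (FractionRing P)
  let ι : P →+* Ω := (algebraMap (FractionRing P) Ω).comp (algebraMap P (FractionRing P))
  have hι : Function.Injective ι :=
    (algebraMap (FractionRing P) Ω).injective.comp (IsFractionRing.injective P (FractionRing P))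
  have hchar : CharZero Ω := by
    refine charZero_of_injective_ringHom (f := ι.comp (MvPolynomial.C : ℤ →+* P)) ?_
    exact hι.comp (MvPolynomial.C_injective K ℤ)
  let ιL : Localization.AtPrime 𝔭 →+* Ω := IsLocalization.lift (M := 𝔭.primeCompl) (g := ι)
    fun y => (isUnit_iff_ne_zero.2 fun h => y.2 (by
      rw [(map_eq_zero_iff ι hι).1 h]
      exact 𝔭.zero_mem))
  -- O dominates the localization of P at 𝔭, so its residue field receives P/𝔭 ≅ K.
  obtain ⟨O, hO, hlocal⟩ := exists_factor_valuationRing ιL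
  refine ⟨Ω, inferInstance, inferInstance, hchar, O, ?_⟩
  let c : Localization.AtPrime 𝔭 →+* O := ιL.codRestrict O.toSubring hO
  let h : P →+* ResidueField O := (residue O).comp (c.comp (algebraMap P (Localization.AtPrime 𝔭)))
  have hker : ∀ x ∈ 𝔭, h x = 0 := by
    intro x hx
    have h1 : c (algebraMap P (Localization.AtPrime 𝔭) x) ∈ maximalIdeal O := by
      rw [mem_maximalIdeal]
      intro hu
      have h2 := hlocal.map_nonunit _ hu
      exact (IsLocalization.AtPrime.isUnit_to_map_iff (Localization.AtPrime 𝔭) 𝔭 x).1 h2 hx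
    exact (residue_eq_zero_iff _).2 h1
  exact ⟨(Ideal.Quotient.lift 𝔭 h hker).comp
    (RingHom.quotientKerEquivOfSurjective hπ).symm.toRingHom⟩

/-- Every field `K` of characteristic `p` is the residue field of a principal ideal domain of
characteristic zero with a maximal ideal generated by `p`. -/
theorem exists_isPrincipalIdealRing_residueField (K : Type u) [Field K] (p : ℕ) [hp : Fact p.Prime]
    [CharP K p] :
    ∃ (W : Type u) (_ : CommRing W) (_ : IsDomain W) (_ : IsPrincipalIdealRing W) (g : W →+* K),
      Function.Surjective g ∧ (∀ w, g w = 0 ↔ (p : W) ∣ w) ∧ (p : W) ≠ 0 := by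
  obtain ⟨Ω, _, _, _, O, ⟨j⟩⟩ := exists_valuationSubring_residueField K
  have : CharP (ResidueField O) p := charP_of_injective_ringHom j.injective p
  obtain ⟨V, hVp, hVk, hVs, hVu⟩ := exists_subring_of_root_lifting p (res := residue O)
    residue_surjective (fun x hx => by
      by_contra h
      exact hx ((residue_eq_zero_iff x).2 ((mem_maximalIdeal x).2 h)))
    O.exists_root_lift j.fieldRange
  let e : K ≃+* j.fieldRange := RingEquiv.ofBijective j.rangeRestrictField
    ⟨j.rangeRestrictField.injective, fun ⟨_, a, h⟩ => ⟨a, Subtype.ext h⟩⟩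
  let f : V →+* K := e.symm.toRingHom.comp
    ((residue O).restrict V j.fieldRange.toSubring fun v hv => hVk v hv)
  have hf : ∀ v : V, j (f v) = residue O v := fun v =>
    congrArg Subtype.val (e.apply_symm_apply
      (((residue O).restrict V j.fieldRange.toSubring fun v hv => hVk v hv) v))
  have hf0 : ∀ v : V, f v = 0 ↔ residue O v = 0 := fun v => by
    rw [← hf v, map_eq_zero j]
  refine exists_discreteValuationRing_quotient (f := f) (p := p) (fun a => ?_) (fun h => ?_)
    (fun v => ?_) (fun v hv => ?_)
  · obtain ⟨v, hv, hva⟩ := hVs (j a) ⟨a, rfl⟩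
    exact ⟨⟨v, hv⟩, j.injective (by rw [hf, hva])⟩
  · have h1 := congrArg (fun v : V => ((v : O) : Ω)) h
    simp only [SubringClass.coe_natCast, ZeroMemClass.coe_zero] at h1
    exact hp.out.ne_zero (Nat.cast_eq_zero.1 h1)
  · rw [hf0]
    constructor
    · intro h
      obtain ⟨w, hw, h⟩ := hVp v v.2 h
      exact ⟨⟨w, hw⟩, Subtype.ext h⟩
    · rintro ⟨w, rfl⟩
      rw [Subring.coe_mul, map_mul, Subring.coe_natCast, map_natCast, CharP.cast_eq_zero, zero_mul]
  · obtain ⟨w, hw, h⟩ := hVu v v.2 (by rwa [Ne, ← hf0])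
    exact IsUnit.of_mul_eq_one ⟨w, hw⟩ (Subtype.ext h)

end CohenRingExists

/-! ### Artinian local rings as quotients of regular local rings -/

section CoverByRegular

variable (R : Type u) [CommRing R] [IsLocalRing R]

/-- Nonzero integers are units in R, so R is a ℚ-algebra. The residue field is separable algebraic
over a purely transcendental extension of ℚ, hence formally smooth, and its identity lifts through
the nilpotent kernel. -/
theorem exists_coefficientField_of_charZero (hnil : IsNilpotent (maximalIdeal R))
    [CharZero (ResidueField R)] :
    ∃ ψ : ResidueField R →+* R, (residue R).comp ψ = RingHom.id _ := by
  have hunit : ∀ n : nonZeroDivisors ℤ, IsUnit (Int.castRingHom R n) := fun n => by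
    by_contra h
    have h1 := (residue_eq_zero_iff _).2 ((mem_maximalIdeal _).2 h)
    rw [eq_intCast, map_intCast, Int.cast_eq_zero] at h1
    exact nonZeroDivisors.ne_zero n.2 h1
  let : Algebra ℚ R := (IsLocalization.lift (S := ℚ) hunit).toAlgebra
  obtain ⟨ι, v, hv⟩ := exists_isTranscendenceBasis' ℚ (ResidueField R)
  have halg := hv.isAlgebraic_field
  have : Algebra.FormallySmooth ℚ (ResidueField R) := .of_algebraicIndependent_of_isSeparable hv.1
  let g : R →ₐ[ℚ] ResidueField R := (residue R).toRatAlgHom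
  have hg : Function.Surjective g := residue_surjective
  have hgnil : IsNilpotent (RingHom.ker g) := by
    have : RingHom.ker g = maximalIdeal R := ker_residue
    rwa [this]
  let ψ := Algebra.FormallySmooth.liftOfSurjective (AlgHom.id ℚ (ResidueField R)) g hg hgnil
  refine ⟨ψ.toRingHom, RingHom.ext fun x => ?_⟩
  exact Algebra.FormallySmooth.liftOfSurjective_apply (AlgHom.id ℚ (ResidueField R)) g hg hgnil x

/-- A local ring with nilpotent maximal ideal receives a ring homomorphism from a principal ideal
domain that is surjective onto the residue field. -/
theorem exists_coefficientRing (hnil : IsNilpotent (maximalIdeal R)) :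
    ∃ (V : Type u) (_ : CommRing V) (_ : IsDomain V) (_ : IsPrincipalIdealRing V) (ψ : V →+* R),
      Function.Surjective ((residue R).comp ψ) := by
  obtain ⟨p, _⟩ := CharP.exists (ResidueField R)
  rcases CharP.char_is_prime_or_zero (ResidueField R) p with hp | rfl
  · have : Fact p.Prime := ⟨hp⟩
    obtain ⟨V, _, _, _, f, hf, hker, hp0⟩ :=
      exists_isPrincipalIdealRing_residueField (ResidueField R) p
    obtain ⟨ψ, hψ⟩ := exists_lift_residue hnil p hf hker fun v hv =>
      (mul_eq_zero.1 hv).resolve_left hp0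
    exact ⟨V, _, ‹_›, ‹_›, ψ, by rwa [hψ]⟩
  · have := CharP.charP_to_charZero (ResidueField R)
    obtain ⟨ψ, hψ⟩ := exists_coefficientField_of_charZero R hnil
    exact ⟨ResidueField R, inferInstance, inferInstance, inferInstance, ψ, by
      rw [hψ]
      exact Function.surjective_id⟩

open Pointwise in
/-- A subring that maps onto the residue field and contains generators of the nilpotent maximal
ideal is everything. -/
theorem subring_eq_top_of_generators (hnil : IsNilpotent (maximalIdeal R)) (T : Subring R)
    (hT : ∀ r, ∃ t ∈ T, r - t ∈ maximalIdeal R) {s : Set R} (hs : s ⊆ T)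
    (hspan : Ideal.span s = maximalIdeal R) : T = ⊤ := by
  obtain ⟨N, hN⟩ := hnil
  -- Descending induction on powers of m: products of generators lie in T, and replacing a
  -- coefficient r by t ∈ T costs an error in the next power.
  have hpow : ∀ n ≤ N, ∀ x ∈ maximalIdeal R ^ (N - n), x ∈ T := by
    intro n
    induction n with
    | zero =>
      intro _ x hx
      rw [Nat.sub_zero, hN] at hx
      rw [show x = 0 from hx]
      exact T.zero_mem
    | succ n ih =>
      intro hn x hx
      have h1 : N - n = (N - (n + 1)) + 1 := by omega
      have ih := ih (by omega)
      rw [h1] at ih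
      generalize N - (n + 1) = m at hx ih
      rw [← hspan, Ideal.span, Submodule.span_pow] at hx
      induction hx using Submodule.span_induction with
      | mem y hy =>
        have hsT : ∀ l : ℕ, s ^ l ⊆ (T : Set R) := fun l => by
          induction l with
          | zero => simp
          | succ l ihl =>
            rw [pow_succ, Set.mul_subset_iff]
            exact fun a ha b hb => T.mul_mem (ihl ha) (hs hb)
        exact hsT m hy
      | zero => exact T.zero_mem
      | add y z _ _ hy hz => exact T.add_mem hy hz
      | smul r y hym hy =>
        obtain ⟨t, ht, hrt⟩ := hT r
        have h2 : r • y = t * y + (r - t) * y := by rw [smul_eq_mul]; ring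
        rw [h2]
        refine T.add_mem (T.mul_mem ht hy) (ih _ ?_)
        rw [pow_succ']
        refine Ideal.mul_mem_mul hrt ?_
        rwa [← hspan, Ideal.span, Submodule.span_pow]
  rw [eq_top_iff]
  intro x _
  exact hpow N le_rfl x (by simp)

/-- Every Artinian local ring is a quotient of a regular local ring. -/
theorem exists_isRegularLocalRing_surjective [IsNoetherianRing R]
    (hnil : IsNilpotent (maximalIdeal R)) :
    ∃ (S : Type u) (_ : CommRing S) (_ : Algebra S R), IsRegularLocalRing S ∧
      Function.Surjective (algebraMap S R) := by
  obtain ⟨V, _, _, _, ψ, hψ⟩ := exists_coefficientRing R hnil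
  obtain ⟨s, hs⟩ := (maximalIdeal R).fg_of_isNoetherianRing
  let P := MvPolynomial s V
  let h : P →+* R := MvPolynomial.eval₂Hom ψ (fun x : s => (x : R))
  have htop : h.range = ⊤ := by
    refine subring_eq_top_of_generators R hnil _ (fun r => ?_) (s := (s : Set R)) (fun x hx => ?_) hs
    · obtain ⟨v, hv⟩ := hψ (residue R r)
      refine ⟨ψ v, ⟨MvPolynomial.C v, MvPolynomial.eval₂Hom_C _ _ _⟩, ?_⟩
      rw [← residue_eq_zero_iff, map_sub, ← hv]
      exact sub_self _
    · exact ⟨MvPolynomial.X ⟨x, hx⟩, MvPolynomial.eval₂Hom_X' _ _ _⟩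
  have hsurj : Function.Surjective h := RingHom.range_eq_top.1 htop
  let 𝔮 : Ideal P := (maximalIdeal R).comap h
  have h𝔮 : 𝔮.IsPrime := Ideal.IsPrime.comap h
  -- Elements outside 𝔮 map to units of R, so the surjection from the regular ring P extends to the
  -- localization.
  let hL : Localization.AtPrime 𝔮 →+* R := IsLocalization.lift (M := 𝔮.primeCompl) (g := h)
    fun y => by
      by_contra hy
      exact y.2 ((mem_maximalIdeal _).2 hy)
  have : IsRegularRing P := inferInstance
  refine ⟨Localization.AtPrime 𝔮, inferInstance, hL.toAlgebra, inferInstance, fun r => ?_⟩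
  obtain ⟨x, rfl⟩ := hsurj r
  exact ⟨algebraMap P _ x, IsLocalization.lift_eq _ x⟩

end CoverByRegular

/-! ### The Gorenstein condition in dimension zero and the equivalences -/

theorem isCohenMacaulayLocal_of_isArtinianRing (R : Type u) [CommRing R] [IsLocalRing R]
    [IsArtinianRing R] (hdim : ringKrullDim R = 0) : IsCohenMacaulayLocal R := by
  refine ⟨inferInstance, inferInstance, ?_⟩
  have h : moduleDepth R R = 0 := by
    refine le_antisymm (iSup₂_le fun rs hrs => ?_) zero_le
    rw [RingTheory.Sequence.eq_nil_of_isRegular_on_artinian hrs]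
    simp
  rw [h, hdim]
  rfl

theorem isGorensteinAsQuotient_iff (R : Type u) [CommRing R] [IsLocalRing R] [IsArtinianRing R]
    (hdim : ringKrullDim R = 0) (S : Type u) [CommRing S] [IsRegularLocalRing S] [Algebra S R]
    (hsurj : Function.Surjective (algebraMap S R)) :
    IsGorensteinAsQuotient S R ↔ HasSimpleSocle R R := by
  constructor
  · rintro ⟨-, -, -, n, d, hn, hd, he⟩
    have hd0 : d = 0 := by
      rw [hdim] at hd
      exact_mod_cast hd.symm
    subst hd0
    exact (nonempty_ext_linearEquiv_iff S R hsurj hn).1 he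
  · intro h
    obtain ⟨rs, -, -, hn⟩ := exists_isWeaklyRegular_ofList_eq_maximalIdeal S
    exact ⟨inferInstance, hsurj, isCohenMacaulayLocal_of_isArtinianRing R hdim,
      rs.length, 0, hn, hdim, (nonempty_ext_linearEquiv_iff S R hsurj hn).2 h⟩

theorem isGrothendieckSerreGorenstein_iff (R : Type u) [CommRing R] [IsLocalRing R]
    [IsArtinianRing R] (hdim : ringKrullDim R = 0) :
    IsGrothendieckSerreGorenstein R ↔ HasSimpleSocle R R := by
  constructor
  · rintro ⟨S, _, _, h⟩
    have := h.regular
    exact (isGorensteinAsQuotient_iff R hdim S h.surjective).1 h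
  · intro h
    obtain ⟨S, _, _, _, hsurj⟩ := exists_isRegularLocalRing_surjective R
      ((isArtinianRing_iff_isNilpotent_maximalIdeal R).1 inferInstance)
    exact ⟨S, _, _, (isGorensteinAsQuotient_iff R hdim S hsurj).2 h⟩

theorem theorem5p3 (R : Type u) [CommRing R] [IsLocalRing R] [IsNoetherianRing R]
    (hdim : ringKrullDim R = 0) :
    List.TFAE
      [Module.Injective R R,
        Nonempty (R ≃ₗ[R] injectiveHull R (ResidueField R)),
        InfIrred (⊥ : Ideal R),
        Module.finrank (ResidueField R) (socle R R) = 1,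
        IsGrothendieckSerreGorenstein R] ∧
    ∀ (S : Type u) [CommRing S] [IsRegularLocalRing S] [Algebra S R],
      Function.Surjective (algebraMap S R) →
        (IsGorensteinAsQuotient S R ↔ IsGrothendieckSerreGorenstein R) := by
  have hart : IsArtinianRing R := by
    rw [isArtinianRing_iff_krullDimLE_zero, Ring.KrullDimLE, Order.krullDimLE_iff, ← ringKrullDim,
      hdim]
    rfl
  have hnil := (isArtinianRing_iff_isNilpotent_maximalIdeal R).1 hart
  refine ⟨?_, fun S _ _ _ hsurj => by
    rw [isGorensteinAsQuotient_iff R hdim S hsurj, isGrothendieckSerreGorenstein_iff R hdim]⟩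
  tfae_have 1 ↔ 2 := (nonempty_linearEquiv_injectiveHull_iff hnil).symm
  tfae_have 1 → 3 := infIrred_bot_of_injective
  tfae_have 3 → 4 := fun h =>
    (hasSimpleSocle_iff_finrank R R).1 (hasSimpleSocle_of_infIrred_bot hnil h)
  tfae_have 4 → 1 := fun h => injective_of_hasSimpleSocle ((hasSimpleSocle_iff_finrank R R).2 h)
  tfae_have 4 ↔ 5 := by
    rw [isGrothendieckSerreGorenstein_iff R hdim, hasSimpleSocle_iff_finrank R R]
  tfae_finish
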